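/- Let $C>0$, $G\ge 0$, $M\ge 0$, $0<Y<2$, and put $\theta=(G-M)/2$, $\tilde\theta=(G+M)/2$. Let $\gamma_{Y/2}$ and $\gamma_{1/2}$ be independent gamma random variables with unit scale and shapes $Y/2$ and $1/2$, and $\mathcal R=\gamma_{Y/2}/\gamma_{1/2}$. Let $\mathcal T=\{\mathcal T(t),t\ge 0\}$ be the time change subordinator of the CGMY process with parameters $C,G,M,Y$, that is, a driftless subordinator with Lévy density $$\nu_{\mathcal T}(x)=C\,\frac{2^{Y/2-1}\Gamma(Y/2)}{\Gamma(Y)}\,\frac{e^{-(\tilde\theta^2-\theta^2)x/2}}{x^{1+Y/2}}\,\mathrm E\!\left[\exp\!\left(-\frac{\tilde\theta^2x}{2}\,\mathcal R\right)\right],\qquad x>0 .$$ Fix $t>0$ and put $\widetilde C=tC2^{Y/2-1}/\Gamma(Y)$. Then for every $L>0$ there are random variables $\mathcal T_L(t)$ and $\epsilon_L(t)$, on the probability space of $\mathcal T$, such that $$\mathcal T(t)=\mathcal T_L(t)+\epsilon_L(t),$$ $\mathcal T_L(t)$ and $\epsilon_L(t)$ are independent, and the following hold. (i) For every $L>0$,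 $\mathcal T_L(t)$ is a generalized gamma convolution random variable (a nonnegative random variable with Laplace transform $\exp(-\int_{(0,\infty)}\log(1+\mu/x)\,U(dx))$, $\mu\ge0$, for some Radon measure $U$ on $(0,\infty)$ with $\int_{(0,1]}|\log x|\,U(dx)<\infty$ and $\int_{(1,\infty)}x^{-1}U(dx)<\infty$), and for all $\mu>0$ $$-\log \mathrm E\!\left[e^{-\mu\mathcal T_L(t)}\right]=\frac{2\widetilde C L^{Y/2}}{Y}\,\mathrm E\left[\log(1+\mu R)\right]<\infty,\qquad R=\frac{1}{\frac{GM+\tilde\theta^2\mathcal R}{2}+\mathcal Z},$$ where $\mathcal Z$ is independent of $\mathcal R$ and has density $\frac Y2L^{-Y/2}z^{Y/2-1}$ on $0\le z\le L$. (ii) As $L\to\infty$, the standardized remainder $(\epsilon_L(t)-\mathrm E[\epsilon_L(t)])/\sqrt{\mathrm{Var}(\epsilon_L(t))}$ converges in distribution to a standard normal random variable. Moreover, for every $L>0$, $\epsilon_L(t)$ is square integrable and $$\mathrm E[\epsilon_L(t)^2]\le\frac{\widetilde C^2}{(1-Y/2)^2L^{2-Y}}+\frac{\widetilde C}{(2-Y/2)L^{2-Y/2}}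 .$$ -/

import Mathlib

open MeasureTheory ProbabilityTheory Filter Set
open scoped NNReal ENNReal

noncomputable section

namespace CGMY

/-- A real-valued process `T` indexed by `[0, ∞)` is a subordinator under `P`: it starts at `0`,
has independent and stationary increments, and almost all its paths are nondecreasing and
right-continuous (hence càdlàg). -/
structure IsSubordinator {Ω : Type*} [MeasurableSpace Ω] (T : ℝ≥0 → Ω → ℝ) (P : Measure Ω) :
    Prop where
  measurable : ∀ s, Measurable (T s)
  zero : ∀ᵐ ω ∂P, T 0 ω = 0
  indep : HasIndepIncrements T P
  stationary : ∀ s h, IdentDistrib (fun ω => T (s + h) ω - T s ω) (T h) P P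
  paths : ∀ᵐ ω ∂P, Monotone (fun s => T s ω) ∧
    ∀ s, ContinuousWithinAt (fun r => T r ω) (Ici s) s

/-- The subordinator `T` has no drift and has Lévy measure `ν(x) dx` on `(0, ∞)`
(Lévy–Khintchine formula of a subordinator). -/
structure HasLevyDensity {Ω : Type*} [MeasurableSpace Ω] (T : ℝ≥0 → Ω → ℝ) (P : Measure Ω)
    (ν : ℝ → ℝ) : Prop where
  nonneg : ∀ x, 0 < x → 0 ≤ ν x
  integrable : IntegrableOn (fun x => min 1 x * ν x) (Ioi 0)
  laplace : ∀ (s : ℝ≥0) (u : ℝ), 0 ≤ u →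
    ∫ ω, Real.exp (-u * T s ω) ∂P =
      Real.exp (-(s : ℝ) * ∫ x in Ioi (0 : ℝ), (1 - Real.exp (-u * x)) * ν x)

/-- The law of `γ_{Y/2} / γ_{1/2}`, for independent gamma variables with unit scale and shapes
`Y/2` and `1/2`. -/
def ratioLaw (Y : ℝ) : Measure ℝ :=
  ((gammaMeasure (Y / 2) 1).prod (gammaMeasure (1 / 2) 1)).map (fun p => p.1 / p.2)

/-- `θ = (G - M) / 2`. -/
def theta (G M : ℝ) : ℝ := (G - M) / 2

/-- `θ̃ = (G + M) / 2`. -/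
def thetaTilde (G M : ℝ) : ℝ := (G + M) / 2

/-- The Lévy density of the time change of the CGMY process with parameters `C, G, M, Y`. -/
def timeChangeLevyDensity (C G M Y : ℝ) (x : ℝ) : ℝ :=
  C * (2 ^ (Y / 2 - 1) * Real.Gamma (Y / 2) / Real.Gamma Y) *
    (Real.exp (-((thetaTilde G M) ^ 2 - (theta G M) ^ 2) * x / 2) / x ^ (1 + Y / 2)) *
    ∫ r, Real.exp (-((thetaTilde G M) ^ 2 * x / 2) * r) ∂(ratioLaw Y)

/-- `C̃ = t C 2^{Y/2 - 1} / Γ(Y)`. -/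
def cTilde (C Y t : ℝ) : ℝ := t * C * 2 ^ (Y / 2 - 1) / Real.Gamma Y

/-- The law on `[0, L]` with density `(Y/2) L^{-Y/2} z^{Y/2 - 1}`. -/
def zLaw (Y L : ℝ) : Measure ℝ :=
  (volume.restrict (Icc 0 L)).withDensity
    (fun z => ENNReal.ofReal (Y / 2 * L ^ (-(Y / 2)) * z ^ (Y / 2 - 1)))

/-- The law of `R = 1 / ((G M + θ̃² ℛ) / 2 + 𝒵)`, where `ℛ` and `𝒵` are independent with laws
`ratioLaw Y` and `zLaw Y L`. -/
def rLaw (G M Y L : ℝ) : Measure ℝ :=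
  ((ratioLaw Y).prod (zLaw Y L)).map
    (fun p => 1 / ((G * M + (thetaTilde G M) ^ 2 * p.1) / 2 + p.2))

/-- A Thorin measure: a Radon measure `U` on `(0, ∞)` with
`∫_{(0,1]} |log x| U(dx) < ∞` and `∫_{(1,∞)} x⁻¹ U(dx) < ∞`. -/
structure IsThorinMeasure (U : Measure ℝ) : Prop where
  support : U (Iic 0) = 0
  radon : ∀ K : Set ℝ, IsCompact K → K ⊆ Ioi 0 → U K < ∞
  near_zero : ∫⁻ x in Ioc 0 1, ENNReal.ofReal |Real.log x| ∂U < ∞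
  at_top : ∫⁻ x in Ioi 1, ENNReal.ofReal x⁻¹ ∂U < ∞

/-- `ρ` is a generalized gamma convolution (without translation term): a probability law on
`[0, ∞)` whose Laplace transform is `exp (-∫ log (1 + u / x) U(dx))` for a Thorin measure `U`. -/
def IsGenGammaConvolution (ρ : Measure ℝ) : Prop :=
  IsProbabilityMeasure ρ ∧ ρ (Iio 0) = 0 ∧
    ∃ U : Measure ℝ, IsThorinMeasure U ∧
      ∀ u : ℝ, 0 ≤ u →
        ∫ x, Real.exp (-u * x) ∂ρ = Real.exp (-∫ x, Real.log (1 + u / x) ∂U)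

end CGMY

end

noncomputable section

namespace CGMY

open scoped Topology

/-! ### Laws on the half-line and their Laplace transforms. -/

section Laplace

/-! The gamma integral turns `x^(-Y/2)` into a mixture of the exponentials `e^{-xz}` with weight
`z^(Y/2-1) dz`. Hence `t ν(x) = x⁻¹ ∫ e^{-ax} U(da)`, where `U` is the image of `ratioLaw Y ⊗ c̃
z^(Y/2-1) dz` under `(r, z) ↦ rate r + z` (`ofReal_timeChangeLevyDensity`). So the law of `T t` is a
generalized gamma convolution with Thorin measure `U`.

Cutting `z` at `L` splits `U` into two pieces and the law of `T t` into a convolution `μ₁ ∗ μ₂`. The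
piece `z ≤ L` is a multiple of the law of `1/R`, and Frullani's integral gives its Laplace exponent.
The piece `z > L` is the remainder: its Lévy measure has `n`-th moment `(n-1)! ∫ a^{-n} dU`, of
order `L^{-(n-Y/2)}`. This gives the second moment bound. It also makes the Lyapunov ratio (third
moment over variance to the power `3/2`) of order at most `L^{-Y/4}`, so the remainder is
asymptotically normal (`tendsto_lyapunov_ratio`,
`tendstoInDistribution_gaussian_of_hasLevyMeasure`).

The two summands must live on the given space. By `exists_splitting`, the conditional law of the
first summand given the sum can be sampled from `T t` and an independent diffuse variable. The
increment `T (2t) - T t` is such a variable: it has the law of `T t`, which is diffuse because its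
Lévy measure is diffuse of infinite mass (`HasLevyMeasure.measure_singleton`). -/

lemma hasSum_cexp (z : ℂ) : HasSum (fun n : ℕ => z ^ n / (n.factorial : ℂ)) (Complex.exp z) := by
  rw [Complex.exp_eq_exp_ℂ]
  exact NormedSpace.expSeries_div_hasSum_exp z

lemma hasSum_rexp (x : ℝ) : HasSum (fun n : ℕ => x ^ n / (n.factorial : ℝ)) (Real.exp x) := by
  rw [Real.exp_eq_exp_ℝ]
  exact NormedSpace.expSeries_div_hasSum_exp x

/-- The characteristic function of a law carried by `[0, 1]` is determined by its moments. -/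
lemma hasSum_charFun_of_mem_Icc {μ : Measure ℝ} [IsProbabilityMeasure μ]
    (h : ∀ᵐ x ∂μ, x ∈ Icc (0 : ℝ) 1) (s : ℝ) :
    HasSum (fun n : ℕ => (s * Complex.I) ^ n / (n.factorial : ℂ) * ((∫ x, x ^ n ∂μ : ℝ) : ℂ))
      (charFun μ s) := by
  have hpow (n : ℕ) : ∀ᵐ x : ℝ ∂μ, ‖((x : ℂ)) ^ n‖ ≤ 1 := by
    filter_upwards [h] with x hx
    rw [norm_pow, Complex.norm_real, Real.norm_of_nonneg hx.1]
    exact pow_le_one₀ hx.1 hx.2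
  have hintg (n : ℕ) : Integrable (fun x : ℝ => (x : ℂ) ^ n) μ :=
    Integrable.of_bound (by fun_prop) 1 (hpow n)
  have key := hasSum_integral_of_summable_integral_norm (μ := μ)
    (F := fun (n : ℕ) (x : ℝ) => (s * Complex.I) ^ n / (n.factorial : ℂ) * (x : ℂ) ^ n)
    (fun n => (hintg n).const_mul _) ?_
  · convert! key using 1
    · ext n
      rw [integral_const_mul, ← integral_complex_ofReal]
      simp
    · rw [charFun_apply_real]
      congr 1
      ext x
      have := (hasSum_cexp (s * x * Complex.I)).tsum_eq
      rw [← this]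
      congr 1
      ext n
      rw [show (s : ℂ) * x * Complex.I = s * Complex.I * x by ring, mul_pow]
      ring
  · refine Summable.of_nonneg_of_le (fun n => integral_nonneg fun _ => norm_nonneg _) ?_
      (hasSum_rexp |s|).summable
    intro n
    calc ∫ x, ‖(s * Complex.I) ^ n / (n.factorial : ℂ) * (x : ℂ) ^ n‖ ∂μ
        ≤ ∫ _, |s| ^ n / n.factorial ∂μ := by
          refine integral_mono_ae ((hintg n).const_mul _).norm (integrable_const _) ?_
          filter_upwards [hpow n] with x hx
          simp only [norm_mul, norm_div, norm_pow, Complex.norm_I, Complex.norm_real,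
            Real.norm_eq_abs, mul_one, Complex.norm_natCast] at hx ⊢
          exact mul_le_of_le_one_right (by positivity) hx
      _ = _ := by simp

/-- Laws on `[0, ∞)` are determined by their Laplace transforms. -/
lemma ext_of_laplace {μ μ' : Measure ℝ} [IsProbabilityMeasure μ] [IsProbabilityMeasure μ']
    (h : ∀ᵐ x ∂μ, 0 ≤ x) (h' : ∀ᵐ x ∂μ', 0 ≤ x)
    (heq : ∀ u : ℝ, 0 ≤ u → ∫ x, Real.exp (-u * x) ∂μ = ∫ x, Real.exp (-u * x) ∂μ') :
    μ = μ' := by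
  have hm : Measurable fun x : ℝ => Real.exp (-x) := by fun_prop
  have hl : Measurable fun x : ℝ => -Real.log x := by fun_prop
  -- The map `x ↦ e^{-x}` sends `[0, ∞)` into `[0, 1]` and turns Laplace transforms at integers into
  -- moments; `-log` undoes it.
  suffices hmap : μ.map (fun x => Real.exp (-x)) = μ'.map (fun x => Real.exp (-x)) by
    have := congrArg (fun ρ : Measure ℝ => ρ.map fun x => -Real.log x) hmap
    simpa [Measure.map_map hl hm, Function.comp_def] using this
  have aux (ρ : Measure ℝ) [IsProbabilityMeasure ρ] (hρ : ∀ᵐ x ∂ρ, 0 ≤ x) (s : ℝ) :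
      HasSum (fun n : ℕ => (s * Complex.I) ^ n / (n.factorial : ℂ) *
        ((∫ x, Real.exp (-(n : ℝ) * x) ∂ρ : ℝ) : ℂ))
        (charFun (ρ.map fun x => Real.exp (-x)) s) := by
    have : IsProbabilityMeasure (ρ.map fun x => Real.exp (-x)) :=
      Measure.isProbabilityMeasure_map hm.aemeasurable
    have := hasSum_charFun_of_mem_Icc (μ := ρ.map fun x => Real.exp (-x)) ?_ s
    · convert! this using 4 with n
      rw [integral_map hm.aemeasurable (by fun_prop)]
      congr 1
      ext x
      rw [← Real.exp_nat_mul]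
      ring_nf
    · refine (ae_map_iff hm.aemeasurable measurableSet_Icc).2 ?_
      filter_upwards [hρ] with x hx
      exact ⟨(Real.exp_pos _).le, Real.exp_le_one_iff.2 (by linarith)⟩
  have : IsProbabilityMeasure (μ.map fun x => Real.exp (-x)) :=
    Measure.isProbabilityMeasure_map hm.aemeasurable
  have : IsProbabilityMeasure (μ'.map fun x => Real.exp (-x)) :=
    Measure.isProbabilityMeasure_map hm.aemeasurable
  refine Measure.ext_of_charFun ?_
  ext s
  refine (aux μ h s).unique ?_
  convert! aux μ' h' s using 4 with n
  exact heq n (Nat.cast_nonneg n)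

end Laplace

/-! ### Compound Poisson laws. -/

section CompoundPoisson

/-- `μ` is a law on `[0, ∞)` whose Laplace–Fourier transform is that of a driftless infinitely
divisible law with Lévy measure `Λ`. -/
structure HasLevyMeasure (μ Λ : Measure ℝ) : Prop where
  prob : IsProbabilityMeasure μ
  nonneg : ∀ᵐ x ∂μ, 0 ≤ x
  transform : ∀ z : ℂ, z.re ≤ 0 →
    ∫ x : ℝ, Complex.exp (z * x) ∂μ = Complex.exp (∫ x : ℝ, (Complex.exp (z * x) - 1) ∂Λ)

lemma norm_cexp_mul_le_one {z : ℂ} (hz : z.re ≤ 0) {x : ℝ} (hx : 0 ≤ x) :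
    ‖Complex.exp (z * x)‖ ≤ 1 := by
  rw [Complex.norm_exp, Complex.re_mul_ofReal]
  exact Real.exp_le_one_iff.2 (mul_nonpos_of_nonpos_of_nonneg hz hx)

lemma integrable_cexp_mul {μ : Measure ℝ} [IsFiniteMeasure μ] (h : ∀ᵐ x ∂μ, 0 ≤ x) {z : ℂ}
    (hz : z.re ≤ 0) : Integrable (fun x : ℝ => Complex.exp (z * x)) μ := by
  refine Integrable.of_bound (by fun_prop) 1 ?_
  filter_upwards [h] with x hx using norm_cexp_mul_le_one hz hx

/-- The `n`-fold convolution power of a measure. -/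
def convPow (ρ : Measure ℝ) : ℕ → Measure ℝ
  | 0 => Measure.dirac 0
  | n + 1 => ρ ∗ convPow ρ n

variable {ρ : Measure ℝ} [IsFiniteMeasure ρ]

instance isFiniteMeasure_convPow (n : ℕ) : IsFiniteMeasure (convPow ρ n) := by
  induction n with
  | zero => unfold convPow; infer_instance
  | succ n ih => unfold convPow; infer_instance

lemma ae_nonneg_conv {μ ν : Measure ℝ} [SFinite μ] [SFinite ν] (hμ : ∀ᵐ x ∂μ, 0 ≤ x)
    (hν : ∀ᵐ x ∂ν, 0 ≤ x) : ∀ᵐ x ∂(μ ∗ ν), 0 ≤ x := by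
  rw [Measure.conv, ae_map_iff (by fun_prop) measurableSet_Ici]
  have h1 : ∀ᵐ p ∂(μ.prod ν), 0 ≤ p.1 := Measure.quasiMeasurePreserving_fst.ae hμ
  have h2 : ∀ᵐ p ∂(μ.prod ν), 0 ≤ p.2 := Measure.quasiMeasurePreserving_snd.ae hν
  filter_upwards [h1, h2] with p hp hq using add_nonneg hp hq

lemma ae_nonneg_convPow (hρ : ∀ᵐ x ∂ρ, 0 ≤ x) (n : ℕ) : ∀ᵐ x ∂(convPow ρ n), 0 ≤ x := by
  induction n with
  | zero => unfold convPow; rw [ae_dirac_iff measurableSet_Ici]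
  | succ n ih => exact ae_nonneg_conv hρ ih

lemma integral_cexp_mul_conv {μ ν : Measure ℝ} [IsFiniteMeasure μ] [IsFiniteMeasure ν]
    (hμ : ∀ᵐ x ∂μ, 0 ≤ x) (hν : ∀ᵐ x ∂ν, 0 ≤ x) {z : ℂ} (hz : z.re ≤ 0) :
    ∫ x : ℝ, Complex.exp (z * x) ∂(μ ∗ ν) =
      (∫ x : ℝ, Complex.exp (z * x) ∂μ) * ∫ x : ℝ, Complex.exp (z * x) ∂ν := by
  rw [integral_conv (integrable_cexp_mul (ae_nonneg_conv hμ hν) hz)]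
  simp_rw [Complex.ofReal_add, mul_add, Complex.exp_add, integral_const_mul]
  rw [integral_mul_const]

lemma integral_cexp_mul_convPow (hρ : ∀ᵐ x ∂ρ, 0 ≤ x) {z : ℂ} (hz : z.re ≤ 0) (n : ℕ) :
    ∫ x : ℝ, Complex.exp (z * x) ∂(convPow ρ n) = (∫ x : ℝ, Complex.exp (z * x) ∂ρ) ^ n := by
  induction n with
  | zero => simp [convPow]
  | succ n ih =>
    rw [convPow, integral_cexp_mul_conv hρ (ae_nonneg_convPow hρ n) hz, ih, pow_succ']

lemma convPow_univ (n : ℕ) : convPow ρ n univ = ρ univ ^ n := by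
  induction n with
  | zero => simp [convPow]
  | succ n ih =>
    rw [convPow, Measure.conv, Measure.map_apply (by fun_prop) MeasurableSet.univ, preimage_univ,
      ← univ_prod_univ, Measure.prod_prod, ih, pow_succ']

lemma conv_singleton_of_noAtoms {μ ν : Measure ℝ} [SFinite μ] [SFinite ν]
    (h : ∀ x, μ {x} = 0) (c : ℝ) : (μ ∗ ν) {c} = 0 := by
  rw [Measure.conv, Measure.map_apply (by fun_prop) (measurableSet_singleton c),
    Measure.prod_apply_symm ((measurableSet_singleton c).preimage (by fun_prop))]
  refine lintegral_eq_zero_of_ae_eq_zero (ae_of_all _ fun y => ?_)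
  refine measure_mono_null (fun x hx => ?_) (h (c - y))
  simp only [mem_preimage, mem_singleton_iff] at hx ⊢
  linarith

/-- The law of a compound Poisson variable with (finite) Lévy measure `ρ`. -/
def compoundPoisson (ρ : Measure ℝ) : Measure ℝ :=
  ENNReal.ofReal (Real.exp (-(ρ.real univ))) •
    Measure.sum fun n : ℕ => ENNReal.ofReal ((n.factorial : ℝ)⁻¹) • convPow ρ n

lemma isProbabilityMeasure_compoundPoisson (ρ : Measure ℝ) [IsFiniteMeasure ρ] :
    IsProbabilityMeasure (compoundPoisson ρ) := by
  constructor
  have h (n : ℕ) : ENNReal.ofReal ((n.factorial : ℝ)⁻¹) * ρ univ ^ n =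
      ENNReal.ofReal (ρ.real univ ^ n / n.factorial) := by
    rw [← ofReal_measureReal, ← ENNReal.ofReal_pow measureReal_nonneg,
      ← ENNReal.ofReal_mul (by positivity)]
    congr 1
    ring
  simp only [compoundPoisson, Measure.smul_apply, Measure.sum_apply _ MeasurableSet.univ,
    convPow_univ, smul_eq_mul, h]
  rw [← ENNReal.ofReal_tsum_of_nonneg (fun n => by positivity) (hasSum_rexp _).summable,
    (hasSum_rexp _).tsum_eq, ← ENNReal.ofReal_mul (Real.exp_pos _).le, ← Real.exp_add]
  simp

lemma ae_nonneg_compoundPoisson (hρ : ∀ᵐ x ∂ρ, 0 ≤ x) : ∀ᵐ x ∂(compoundPoisson ρ), 0 ≤ x := by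
  refine Measure.ae_smul_measure ?_ _
  rw [Measure.ae_sum_iff]
  intro n
  exact Measure.ae_smul_measure (ae_nonneg_convPow hρ n) _

lemma hasLevyMeasure_compoundPoisson (hρ : ∀ᵐ x ∂ρ, 0 ≤ x) :
    HasLevyMeasure (compoundPoisson ρ) ρ where
  prob := isProbabilityMeasure_compoundPoisson ρ
  nonneg := ae_nonneg_compoundPoisson hρ
  transform z hz := by
    have := isProbabilityMeasure_compoundPoisson ρ
    have hne : ENNReal.ofReal (Real.exp (-(ρ.real univ))) ≠ 0 := by simp [Real.exp_pos]
    have hintg : Integrable (fun x : ℝ => Complex.exp (z * x))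
        (Measure.sum fun n : ℕ => ENNReal.ofReal ((n.factorial : ℝ)⁻¹) • convPow ρ n) :=
      (integrable_smul_measure hne ENNReal.ofReal_ne_top).1
        (integrable_cexp_mul (ae_nonneg_compoundPoisson hρ) hz)
    have hsum := hasSum_integral_measure hintg
    have h2 := hasSum_cexp (∫ x : ℝ, Complex.exp (z * x) ∂ρ)
    rw [compoundPoisson, integral_smul_measure, ENNReal.toReal_ofReal (Real.exp_pos _).le,
      integral_sub (integrable_cexp_mul hρ hz) (integrable_const _), sub_eq_neg_add,
      Complex.exp_add, Complex.real_smul, integral_const, Complex.real_smul, mul_one,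
      Complex.ofReal_exp, Complex.ofReal_neg]
    congr 1
    refine hsum.unique ?_
    convert! h2 using 2 with n
    rw [integral_smul_measure, ENNReal.toReal_ofReal (by positivity),
      integral_cexp_mul_convPow hρ hz, Complex.real_smul, Complex.ofReal_inv,
      Complex.ofReal_natCast, div_eq_inv_mul]

/-- A convolution with a diffuse factor is diffuse, so only the term without jumps can charge a
point, and its weight is `e^{-ρ(ℝ)}`. -/
lemma compoundPoisson_singleton_le (h : ∀ x, ρ {x} = 0) (c : ℝ) :
    compoundPoisson ρ {c} ≤ ENNReal.ofReal (Real.exp (-(ρ.real univ))) := by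
  rw [compoundPoisson, Measure.smul_apply, Measure.sum_apply _ (measurableSet_singleton c),
    tsum_eq_single 0]
  · refine mul_le_of_le_one_right' ?_
    simpa [convPow] using (prob_le_one : Measure.dirac (0 : ℝ) {c} ≤ 1)
  · intro n hn
    obtain ⟨m, rfl⟩ := Nat.exists_eq_succ_of_ne_zero hn
    simp [convPow, conv_singleton_of_noAtoms h c]

end CompoundPoisson

/-! ### Existence, uniqueness and diffuseness of driftless infinitely divisible laws. -/

section LevyLaw

lemma min_one_le_two_mul_one_sub_exp {x : ℝ} (hx : 0 ≤ x) :
    min 1 x ≤ 2 * (1 - Real.exp (-x)) := by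
  have h1 : Real.exp (-x) ≤ 1 / (1 + x) := by
    rw [Real.exp_neg, one_div]
    exact inv_anti₀ (by linarith) (by linarith [Real.add_one_le_exp x])
  have h2 : 1 / (1 + x) = 1 - x / (1 + x) := by field_simp; ring
  have h3 : min 1 x ≤ 2 * (x / (1 + x)) := by
    rw [← mul_div_assoc, le_div_iff₀ (by linarith)]
    rcases le_total 1 x with h | h
    · rw [min_eq_left h]; linarith
    · rw [min_eq_right h]; nlinarith
  linarith

lemma one_sub_exp_neg_nonneg {x : ℝ} (hx : 0 ≤ x) : 0 ≤ 1 - Real.exp (-x) := by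
  have := Real.exp_le_one_iff.2 (neg_nonpos.2 hx)
  linarith

/-- One dominating function serves the whole half-plane `Re z ≤ 0`, so integrability of `1 - e^{-x}`
is the only condition needed on a Lévy measure. -/
lemma norm_cexp_sub_one_le {z : ℂ} (hz : z.re ≤ 0) {x : ℝ} (hx : 0 ≤ x) :
    ‖Complex.exp (z * x) - 1‖ ≤ 4 * (1 + ‖z‖) * (1 - Real.exp (-x)) := by
  have h0 := one_sub_exp_neg_nonneg hx
  have hm := min_one_le_two_mul_one_sub_exp hx
  have hz0 := norm_nonneg z
  have hn : ‖z * (x : ℂ)‖ = ‖z‖ * x := by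
    rw [norm_mul, Complex.norm_real, Real.norm_of_nonneg hx]
  have h2 : ‖Complex.exp (z * x) - 1‖ ≤ 2 := by
    refine (norm_sub_le _ _).trans ?_
    rw [norm_one]
    linarith [norm_cexp_mul_le_one hz hx]
  rcases le_total 1 x with h | h
  · rw [min_eq_left h] at hm
    nlinarith
  · rw [min_eq_right h] at hm
    rcases le_total 1 (‖z‖ * x) with h' | h'
    · nlinarith
    · have := Complex.norm_exp_sub_one_le (x := z * x) (by rwa [hn])
      rw [hn] at this
      nlinarith

lemma integrable_one_sub_exp {Λ : Measure ℝ} (h0 : ∀ᵐ x ∂Λ, 0 ≤ x)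
    (hfin : ∫⁻ x, ENNReal.ofReal (1 - Real.exp (-x)) ∂Λ < ∞) :
    Integrable (fun x => 1 - Real.exp (-x)) Λ := by
  refine ⟨by fun_prop, (hasFiniteIntegral_iff_ofReal ?_).2 hfin⟩
  filter_upwards [h0] with x hx using one_sub_exp_neg_nonneg hx

lemma integrable_cexp_sub_one {Λ : Measure ℝ} (h0 : ∀ᵐ x ∂Λ, 0 ≤ x)
    (hfin : ∫⁻ x, ENNReal.ofReal (1 - Real.exp (-x)) ∂Λ < ∞) {z : ℂ} (hz : z.re ≤ 0) :
    Integrable (fun x : ℝ => Complex.exp (z * x) - 1) Λ := by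
  refine ((integrable_one_sub_exp h0 hfin).const_mul (4 * (1 + ‖z‖))).mono' (by fun_prop) ?_
  filter_upwards [h0] with x hx using norm_cexp_sub_one_le hz hx

lemma HasLevyMeasure.laplace {μ Λ : Measure ℝ} (h : HasLevyMeasure μ Λ) {u : ℝ} (hu : 0 ≤ u) :
    ∫ x, Real.exp (-u * x) ∂μ = Real.exp (-∫ x, (1 - Real.exp (-u * x)) ∂Λ) := by
  have := h.transform (-u : ℝ) (by simpa using hu)
  have e1 : ∫ x : ℝ, Complex.exp ((-u : ℝ) * x) ∂μ = ((∫ x, Real.exp (-u * x) ∂μ : ℝ) : ℂ) := by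
    rw [← integral_complex_ofReal]; simp
  have e2 : ∫ x : ℝ, (Complex.exp ((-u : ℝ) * x) - 1) ∂Λ =
      ((-∫ x, (1 - Real.exp (-u * x)) ∂Λ : ℝ) : ℂ) := by
    rw [← integral_neg, ← integral_complex_ofReal]; simp
  rw [e1, e2, ← Complex.ofReal_exp] at this
  exact_mod_cast this

/-- The terms `1 - e^{-f n}` tend to `0`, so eventually `f n < 1`, where `f n ≤ 2 (1 - e^{-f n})`.
-/
lemma summable_of_tsum_one_sub_exp {f : ℕ → ℝ} (h0 : ∀ n, 0 ≤ f n)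
    (h : ∑' n, ENNReal.ofReal (1 - Real.exp (-f n)) ≠ ∞) : Summable f := by
  have hs : Summable fun n => 1 - Real.exp (-f n) := by
    have := ENNReal.summable_toReal h
    simpa [ENNReal.toReal_ofReal (one_sub_exp_neg_nonneg (h0 _))] using this
  have hlim : ∀ᶠ n in atTop, 2 * (1 - Real.exp (-f n)) < 1 := by
    have := (hs.tendsto_atTop_zero.const_mul 2)
    rw [mul_zero] at this
    exact this.eventually_lt_const one_pos
  refine Summable.of_norm_bounded_eventually_nat (hs.mul_left 2) ?_
  filter_upwards [hlim] with n hn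
  rw [Real.norm_of_nonneg (h0 n)]
  have := min_one_le_two_mul_one_sub_exp (h0 n)
  rcases le_total 1 (f n) with h' | h'
  · rw [min_eq_left h'] at this; linarith
  · rwa [min_eq_right h'] at this

/-- Existence of the driftless infinitely divisible law on `[0, ∞)` with given Lévy measure. -/
theorem exists_hasLevyMeasure (Λ : Measure ℝ) [SFinite Λ] (h0 : ∀ᵐ x ∂Λ, 0 ≤ x)
    (hfin : ∫⁻ x, ENNReal.ofReal (1 - Real.exp (-x)) ∂Λ < ∞) : ∃ μ, HasLevyMeasure μ Λ := by
  -- The law is built as that of a series of independent compound Poisson variables, one for each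
  -- finite piece of `Λ`.
  set R : ℕ → Measure ℝ := sfiniteSeq Λ with hR
  have hsum : Measure.sum R = Λ := sum_sfiniteSeq Λ
  have hR0 (n : ℕ) : ∀ᵐ x ∂(R n), 0 ≤ x := by
    rw [← hsum, Measure.ae_sum_iff] at h0
    exact h0 n
  have hCP (n : ℕ) := hasLevyMeasure_compoundPoisson (hR0 n)
  have (n : ℕ) : IsProbabilityMeasure (compoundPoisson (R n)) := (hCP n).prob
  set Q := Measure.infinitePi fun n => compoundPoisson (R n) with hQ
  have hev (n : ℕ) : Measurable fun ω : ℕ → ℝ => ω n := measurable_pi_apply n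
  have hmap (n : ℕ) : Q.map (fun ω => ω n) = compoundPoisson (R n) :=
    Measure.infinitePi_map_eval _ n
  have hpos : ∀ᵐ ω ∂Q, ∀ n, 0 ≤ ω n := by
    rw [ae_all_iff]
    intro n
    have := (hCP n).nonneg
    rw [← hmap n, ae_map_iff (hev n).aemeasurable measurableSet_Ici] at this
    exact this
  -- With `ψ = ∫ (1 - e^{-x}) dR n`, the left side is `1 - e^{-ψ} ≤ ψ`.
  have hone (n : ℕ) : ∫⁻ ω, ENNReal.ofReal (1 - Real.exp (-ω n)) ∂Q ≤
      ∫⁻ x, ENNReal.ofReal (1 - Real.exp (-x)) ∂(R n) := by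
    have hfin' : ∫⁻ x, ENNReal.ofReal (1 - Real.exp (-x)) ∂(R n) < ∞ :=
      (lintegral_mono' (sfiniteSeq_le Λ n) le_rfl).trans_lt hfin
    have hi := integrable_one_sub_exp (hR0 n) hfin'
    have hie : Integrable (fun x => Real.exp (-x)) (compoundPoisson (R n)) := by
      refine Integrable.of_bound (by fun_prop) 1 ?_
      filter_upwards [(hCP n).nonneg] with x hx
      rw [Real.norm_of_nonneg (Real.exp_pos _).le]
      exact Real.exp_le_one_iff.2 (by linarith)
    have e : ∫⁻ ω, ENNReal.ofReal (1 - Real.exp (-ω n)) ∂Q =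
        ∫⁻ x, ENNReal.ofReal (1 - Real.exp (-x)) ∂compoundPoisson (R n) := by
      rw [← hmap n, lintegral_map (by fun_prop) (by fun_prop)]
    rw [e, ← ofReal_integral_eq_lintegral_ofReal (f := fun x => 1 - Real.exp (-x))
      ((integrable_const _).sub hie)
      ((hCP n).nonneg.mono fun x hx => one_sub_exp_neg_nonneg hx),
      ← ofReal_integral_eq_lintegral_ofReal hi
      ((hR0 n).mono fun x hx => one_sub_exp_neg_nonneg hx)]
    refine ENNReal.ofReal_le_ofReal ?_
    have hl := (hCP n).laplace zero_le_one
    simp only [neg_mul, one_mul] at hl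
    rw [integral_sub (integrable_const _) hie, hl]
    simp only [integral_const, probReal_univ, smul_eq_mul, mul_one]
    linarith [Real.add_one_le_exp (-∫ x, (1 - Real.exp (-x)) ∂(R n))]
  have hcm (n : ℕ) : Measurable fun ω : ℕ → ℝ => ENNReal.ofReal (1 - Real.exp (-ω n)) := by
    fun_prop
  -- Summing these bounds gives `∑ (1 - e^{-ω n})` a finite expectation, hence an almost surely
  -- finite value.
  have hsummable : ∀ᵐ ω ∂Q, Summable ω := by
    have hlt : ∫⁻ ω, ∑' n, ENNReal.ofReal (1 - Real.exp (-ω n)) ∂Q ≠ ∞ := by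
      rw [lintegral_tsum (fun n => (hcm n).aemeasurable)]
      refine ((ENNReal.tsum_le_tsum hone).trans_lt ?_).ne
      rwa [← lintegral_sum_measure, hsum]
    filter_upwards [ae_lt_top (Measurable.tsum hcm) hlt, hpos] with ω hω hω'
    exact summable_of_tsum_one_sub_exp hω' hω.ne
  have hSm : Measurable fun ω : ℕ → ℝ => ∑' n, ω n := by fun_prop
  refine ⟨Q.map fun ω => ∑' n, ω n, Measure.isProbabilityMeasure_map hSm.aemeasurable, ?_, ?_⟩
  · rw [ae_map_iff hSm.aemeasurable measurableSet_Ici]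
    filter_upwards [hpos] with ω hω using tsum_nonneg hω
  · intro z hz
    rw [integral_map hSm.aemeasurable (by fun_prop)]
    have hind : iIndepFun (fun (n : ℕ) (ω : ℕ → ℝ) => ω n) Q :=
      iIndepFun_infinitePi (X := fun _ x => x) (fun _ => measurable_id)
    have hprod (N : ℕ) : ∫ ω, Complex.exp (z * ((∑ n ∈ Finset.range N, ω n : ℝ) : ℂ)) ∂Q =
        Complex.exp (∑ n ∈ Finset.range N, ∫ x : ℝ, (Complex.exp (z * x) - 1) ∂(R n)) := by
      have hind' : iIndepFun (fun (n : Fin N) (ω : ℕ → ℝ) => ω n) Q :=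
        hind.precomp Fin.val_injective
      have := hind'.integral_fun_prod_comp (f := fun _ (x : ℝ) => Complex.exp (z * x))
        (fun n => (hev _).aemeasurable) (fun n => by fun_prop)
      rw [Complex.exp_sum, ← Fin.prod_univ_eq_prod_range
        (fun n => Complex.exp (∫ x : ℝ, (Complex.exp (z * x) - 1) ∂(R n)))]
      convert! this using 2
      · ext ω
        rw [← Complex.exp_sum, Finset.sum_range, Complex.ofReal_sum, Finset.mul_sum]
      · rename_i n _
        rw [← (hCP n).transform z hz, ← hmap n, integral_map (hev _).aemeasurable (by fun_prop)]
    have hL : Tendsto (fun N => ∫ ω, Complex.exp (z * ((∑ n ∈ Finset.range N, ω n : ℝ) : ℂ)) ∂Q)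
        atTop (𝓝 (∫ ω, Complex.exp (z * ((∑' n, ω n : ℝ) : ℂ)) ∂Q)) := by
      refine tendsto_integral_of_dominated_convergence (fun _ => 1) (fun N => by fun_prop)
        (integrable_const _) (fun N => ?_) ?_
      · filter_upwards [hpos] with ω hω
        exact norm_cexp_mul_le_one hz (Finset.sum_nonneg fun n _ => hω n)
      · filter_upwards [hsummable] with ω hω
        have h1 := hω.hasSum.tendsto_sum_nat
        exact (Complex.continuous_exp.comp (continuous_const.mul
          Complex.continuous_ofReal)).continuousAt.tendsto.comp h1
    refine tendsto_nhds_unique hL ?_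
    simp_rw [hprod]
    refine (Complex.continuous_exp.tendsto _).comp ?_
    have hi := integrable_cexp_sub_one h0 hfin hz
    rw [← hsum] at hi
    have := (hasSum_integral_measure hi).tendsto_sum_nat
    rwa [hsum] at this

lemma HasLevyMeasure.conv {μ μ' Λ Λ' : Measure ℝ} (h : HasLevyMeasure μ Λ)
    (h' : HasLevyMeasure μ' Λ')
    (hi : ∀ z : ℂ, z.re ≤ 0 → Integrable (fun x : ℝ => Complex.exp (z * x) - 1) Λ)
    (hi' : ∀ z : ℂ, z.re ≤ 0 → Integrable (fun x : ℝ => Complex.exp (z * x) - 1) Λ') :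
    HasLevyMeasure (μ ∗ μ') (Λ + Λ') := by
  have := h.prob
  have := h'.prob
  refine ⟨inferInstance, ae_nonneg_conv h.nonneg h'.nonneg, fun z hz => ?_⟩
  rw [integral_cexp_mul_conv h.nonneg h'.nonneg hz, h.transform z hz, h'.transform z hz,
    integral_add_measure (hi z hz) (hi' z hz), Complex.exp_add]

lemma HasLevyMeasure.unique {μ μ' Λ : Measure ℝ} (h : HasLevyMeasure μ Λ)
    (h' : HasLevyMeasure μ' Λ) : μ = μ' := by
  have := h.prob
  have := h'.prob
  exact ext_of_laplace h.nonneg h'.nonneg fun u hu => by rw [h.laplace hu, h'.laplace hu]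

/-- An infinitely divisible law on `[0, ∞)` with diffuse Lévy measure of infinite mass is
diffuse. -/
lemma HasLevyMeasure.measure_singleton {μ Λ : Measure ℝ} [SFinite Λ] (h : HasLevyMeasure μ Λ)
    (h0 : ∀ᵐ x ∂Λ, 0 < x) (hfin : ∫⁻ x, ENNReal.ofReal (1 - Real.exp (-x)) ∂Λ < ∞)
    (hatom : ∀ x, Λ {x} = 0) (htop : Λ univ = ∞) (c : ℝ) : μ {c} = 0 := by
  -- The jumps larger than `1/(k+1)` form a compound Poisson factor. Once their mass exceeds `M`,
  -- its atoms are at most `e^{-M}`, and convolution with the law of the other jumps cannot enlarge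
  -- the largest atom.
  have hle (M : ℝ) : μ {c} ≤ ENNReal.ofReal (Real.exp (-M)) := by
    set S : ℕ → Set ℝ := fun k => Ioi ((k + 1 : ℝ)⁻¹) with hS
    have hSmono : Monotone S := by
      intro k l hkl
      refine Ioi_subset_Ioi (inv_anti₀ (by positivity) ?_)
      gcongr
    have hSU : ⋃ k, S k = Ioi 0 := by
      ext x
      simp only [mem_iUnion, mem_Ioi, hS]
      constructor
      · rintro ⟨k, hk⟩
        exact lt_trans (by positivity) hk
      · intro hx
        obtain ⟨k, hk⟩ := exists_nat_one_div_lt hx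
        exact ⟨k, by simpa using hk⟩
    have htend := tendsto_measure_iUnion_atTop (μ := Λ) hSmono
    have hΛ : Λ (⋃ k, S k) = ∞ := by
      rw [hSU, ← htop]
      exact measure_congr (ae_eq_univ.2 h0)
    rw [hΛ] at htend
    obtain ⟨k, hk⟩ := (htend.eventually (lt_mem_nhds (ENNReal.ofReal_lt_top (r := M)))).exists
    have hSm : MeasurableSet (S k) := measurableSet_Ioi
    have hfinS : Λ (S k) < ∞ := by
      have hpos : 0 < ENNReal.ofReal (1 - Real.exp (-(k + 1 : ℝ)⁻¹)) := by
        rw [ENNReal.ofReal_pos, sub_pos, Real.exp_lt_one_iff, neg_lt_zero]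
        positivity
      have hmk : ENNReal.ofReal (1 - Real.exp (-(k + 1 : ℝ)⁻¹)) * Λ (S k) ≤
          ∫⁻ x, ENNReal.ofReal (1 - Real.exp (-x)) ∂Λ := by
        rw [← setLIntegral_const]
        refine (setLIntegral_mono (by fun_prop) fun x hx => ?_).trans
          (setLIntegral_le_lintegral _ _)
        refine ENNReal.ofReal_le_ofReal (sub_le_sub_left (Real.exp_le_exp.2 ?_) _)
        exact neg_le_neg (le_of_lt hx)
      exact ENNReal.lt_top_of_mul_ne_top_right (hmk.trans_lt hfin).ne hpos.ne'
    have : IsFiniteMeasure (Λ.restrict (S k)) := ⟨by simpa using hfinS⟩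
    have h0' : ∀ᵐ x ∂Λ, 0 ≤ x := h0.mono fun x hx => hx.le
    have hr (A : Set ℝ) : ∀ᵐ x ∂(Λ.restrict A), 0 ≤ x := ae_restrict_of_ae h0'
    have hf (A : Set ℝ) : ∫⁻ x in A, ENNReal.ofReal (1 - Real.exp (-x)) ∂Λ < ∞ :=
      (setLIntegral_le_lintegral _ _).trans_lt hfin
    obtain ⟨μ', hμ'⟩ := exists_hasLevyMeasure (Λ.restrict (S k)ᶜ) (hr _) (hf _)
    have hconv := (hasLevyMeasure_compoundPoisson (hr (S k))).conv hμ'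
      (fun z hz => integrable_cexp_sub_one (hr _) (hf _) hz)
      (fun z hz => integrable_cexp_sub_one (hr _) (hf _) hz)
    rw [Measure.restrict_add_restrict_compl hSm] at hconv
    have := hμ'.prob
    have := isProbabilityMeasure_compoundPoisson (Λ.restrict (S k))
    rw [h.unique hconv, Measure.conv, Measure.map_apply (by fun_prop) (measurableSet_singleton c),
      Measure.prod_apply_symm ((measurableSet_singleton c).preimage (by fun_prop))]
    have hb (y : ℝ) : compoundPoisson (Λ.restrict (S k))
        ((fun x => (x, y)) ⁻¹' ((fun p : ℝ × ℝ => p.1 + p.2) ⁻¹' {c})) ≤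
        ENNReal.ofReal (Real.exp (-M)) := by
      refine (measure_mono (t := {c - y}) fun x hx => ?_).trans
        ((compoundPoisson_singleton_le (fun x => ?_) (c - y)).trans ?_)
      · simp only [mem_preimage, mem_singleton_iff] at hx ⊢
        linarith
      · exact le_antisymm ((Measure.restrict_apply_le _ _).trans (hatom x).le) zero_le
      · refine ENNReal.ofReal_le_ofReal (Real.exp_le_exp.2 (neg_le_neg ?_))
        rw [measureReal_def, Measure.restrict_apply_univ]
        exact (ENNReal.ofReal_le_iff_le_toReal hfinS.ne).1 hk.le
    refine (lintegral_mono hb).trans ?_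
    simp
  have hlim : Tendsto (fun M : ℝ => ENNReal.ofReal (Real.exp (-M))) atTop (𝓝 0) := by
    rw [← ENNReal.ofReal_zero]
    exact ENNReal.tendsto_ofReal (Real.tendsto_exp_neg_atTop_nhds_zero)
  exact le_antisymm (ge_of_tendsto' hlim hle) zero_le

end LevyLaw

/-! ### Moments through the behaviour of the Laplace exponent at zero. -/

section Moments

/-- Working with `dslope` avoids dividing by `p i`, which may vanish. -/
lemma tendsto_exp_sub_one_div {ι : Type*} {l : Filter ι} {p v : ι → ℝ} {m : ℝ}
    (hp : Tendsto p l (𝓝 0)) (hpv : Tendsto (fun i => p i / v i) l (𝓝 m)) :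
    Tendsto (fun i => (Real.exp (p i) - 1) / v i) l (𝓝 m) := by
  have hc : ContinuousAt (dslope Real.exp 0) 0 :=
    continuousAt_dslope_same.2 Real.differentiableAt_exp
  have h1 : Tendsto (fun i => dslope Real.exp 0 (p i)) l (𝓝 1) := by
    have := hc.tendsto.comp hp
    rw [dslope_same, Real.deriv_exp, Real.exp_zero] at this
    exact this
  have h2 := h1.mul hpv
  rw [one_mul] at h2
  refine h2.congr fun i => ?_
  have := sub_smul_dslope Real.exp 0 (p i)
  rw [sub_zero, smul_eq_mul, Real.exp_zero] at this
  rw [← this]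
  ring

/-- A bounded approximation of the identity on `[0, ∞)`. -/
def expApprox (u x : ℝ) : ℝ := (1 - Real.exp (-u * x)) / u

lemma expApprox_nonneg {u x : ℝ} (hu : 0 < u) (hx : 0 ≤ x) : 0 ≤ expApprox u x := by
  refine div_nonneg ?_ hu.le
  rw [neg_mul]
  exact one_sub_exp_neg_nonneg (by positivity)

lemma expApprox_le {u x : ℝ} (hu : 0 < u) : expApprox u x ≤ x := by
  rw [expApprox, div_le_iff₀ hu]
  linarith [Real.add_one_le_exp (-u * x)]

lemma measurable_expApprox (u : ℝ) : Measurable (expApprox u) := by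
  unfold expApprox; fun_prop

lemma tendsto_expApprox {u : ℕ → ℝ} (hu : ∀ n, 0 < u n) (hu0 : Tendsto u atTop (𝓝 0)) (x : ℝ) :
    Tendsto (fun n => expApprox (u n) x) atTop (𝓝 x) := by
  have h := tendsto_exp_sub_one_div (p := fun n => -u n * x) (v := fun n => -u n) (m := x)
    (l := atTop) (by simpa using (hu0.neg.mul_const x)) ?_
  · refine h.congr fun n => ?_
    rw [expApprox, div_neg, ← neg_div, neg_sub]
  · refine tendsto_const_nhds.congr fun n => ?_
    rw [mul_div_assoc, mul_div_cancel₀]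
    exact (neg_neg_of_pos (hu n)).ne

lemma tendsto_integral_expApprox {ρ : Measure ℝ} (h0 : ∀ᵐ x ∂ρ, 0 ≤ x) {u : ℕ → ℝ}
    (hu : ∀ n, 0 < u n) (hu0 : Tendsto u atTop (𝓝 0)) (k : ℕ)
    (hi : Integrable (fun x => x ^ k) ρ) :
    Tendsto (fun n => ∫ x, expApprox (u n) x ^ k ∂ρ) atTop (𝓝 (∫ x, x ^ k ∂ρ)) := by
  refine tendsto_integral_of_dominated_convergence (fun x => x ^ k)
    (fun n => ((measurable_expApprox _).pow_const k).aestronglyMeasurable) hi (fun n => ?_) ?_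
  · filter_upwards [h0] with x hx
    rw [Real.norm_of_nonneg (pow_nonneg (expApprox_nonneg (hu n) hx) k)]
    exact pow_le_pow_left₀ (expApprox_nonneg (hu n) hx) (expApprox_le (hu n)) k
  · exact ae_of_all _ fun x => (tendsto_expApprox hu hu0 x).pow k

variable {μ Λ : Measure ℝ}

lemma integrable_one_sub_exp_mul (h0 : ∀ᵐ x ∂Λ, 0 ≤ x) (hi : Integrable (fun x => x) Λ) {u : ℝ}
    (hu : 0 ≤ u) : Integrable (fun x => 1 - Real.exp (-u * x)) Λ := by
  refine (hi.const_mul u).mono' (by fun_prop) ?_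
  filter_upwards [h0] with x hx
  rw [neg_mul, Real.norm_of_nonneg (one_sub_exp_neg_nonneg (by positivity))]
  linarith [Real.add_one_le_exp (-(u * x))]

lemma integrable_exp_neg_mul [IsFiniteMeasure μ] (h0 : ∀ᵐ x ∂μ, 0 ≤ x) {u : ℝ} (hu : 0 ≤ u) :
    Integrable (fun x => Real.exp (-u * x)) μ := by
  refine Integrable.of_bound (by fun_prop) 1 ?_
  filter_upwards [h0] with x hx
  rw [Real.norm_of_nonneg (Real.exp_pos _).le]
  exact Real.exp_le_one_iff.2 (mul_nonpos_of_nonpos_of_nonneg (by linarith) hx)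

/-- First and second moments of an infinitely divisible law in terms of its Lévy measure. -/
lemma HasLevyMeasure.moments (h : HasLevyMeasure μ Λ) (h0 : ∀ᵐ x ∂Λ, 0 ≤ x)
    (hi1 : Integrable (fun x => x) Λ) (hi2 : Integrable (fun x => x ^ 2) Λ) :
    MemLp id 2 μ ∧ ∫ x, x ∂μ = ∫ x, x ∂Λ ∧
      ∫ x, x ^ 2 ∂μ = (∫ x, x ∂Λ) ^ 2 + ∫ x, x ^ 2 ∂Λ := by
  have := h.prob
  set u : ℕ → ℝ := fun n => 1 / ((n : ℝ) + 1) with hudef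
  have hu (n : ℕ) : 0 < u n := by positivity
  have hu0 : Tendsto u atTop (𝓝 0) := tendsto_one_div_add_atTop_nhds_zero_nat
  set ψ : ℝ → ℝ := fun u => ∫ x, (1 - Real.exp (-u * x)) ∂Λ with hψ
  set φ : ℝ → ℝ := fun u => ∫ x, Real.exp (-u * x) ∂μ with hφ
  have hφψ {v : ℝ} (hv : 0 ≤ v) : φ v = Real.exp (-ψ v) := h.laplace hv
  have hψ1 : Tendsto (fun n => ψ (u n) / u n) atTop (𝓝 (∫ x, x ∂Λ)) := by
    have := tendsto_integral_expApprox h0 hu hu0 1 (by simpa using hi1)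
    simp only [pow_one] at this
    refine this.congr fun n => ?_
    simp only [expApprox, integral_div, hψ]
  have hψ0 : Tendsto (fun n => ψ (u n)) atTop (𝓝 0) := by
    have := hψ1.mul hu0
    rw [mul_zero] at this
    exact this.congr fun n => div_mul_cancel₀ _ (hu n).ne'
  -- This second difference of `ψ` equals `∫ (1 - e^{-ux})² dΛ`.
  have hδ : Tendsto (fun n => (2 * ψ (u n) - ψ (2 * u n)) / u n ^ 2) atTop
      (𝓝 (∫ x, x ^ 2 ∂Λ)) := by
    refine (tendsto_integral_expApprox h0 hu hu0 2 hi2).congr fun n => ?_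
    simp only [expApprox, div_pow, integral_div, hψ]
    congr 1
    rw [← integral_const_mul, ← integral_sub
      ((integrable_one_sub_exp_mul h0 hi1 (hu n).le).const_mul 2)
      (integrable_one_sub_exp_mul h0 hi1 (by linarith [hu n]))]
    congr 1
    ext x
    rw [show -(2 * u n) * x = (-u n * x) + (-u n * x) by ring, Real.exp_add]
    ring
  have hδ0 : Tendsto (fun n => 2 * ψ (u n) - ψ (2 * u n)) atTop (𝓝 0) := by
    have := hδ.mul (hu0.pow 2)
    rw [zero_pow two_ne_zero, mul_zero] at this
    exact this.congr fun n => div_mul_cancel₀ _ (pow_ne_zero 2 (hu n).ne')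
  have hφ1 : Tendsto (fun n => φ (u n)) atTop (𝓝 1) := by
    have := (Real.continuous_exp.tendsto 0).comp (by simpa using hψ0.neg)
    rw [Real.exp_zero] at this
    exact this.congr fun n => (hφψ (hu n).le).symm
  have hI1 : Tendsto (fun n => ∫ x, expApprox (u n) x ∂μ) atTop (𝓝 (∫ x, x ∂Λ)) := by
    have := tendsto_exp_sub_one_div (p := fun n => -ψ (u n)) (v := fun n => -u n)
      (by simpa using hψ0.neg) (by simpa using hψ1)
    refine this.congr fun n => ?_
    simp only [expApprox, integral_div]
    rw [integral_sub (integrable_const _) (integrable_exp_neg_mul h.nonneg (hu n).le),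
      ← hφψ (hu n).le]
    simp only [integral_const, probReal_univ, smul_eq_mul, mul_one, hφ]
    rw [div_neg, ← neg_div, neg_sub]
  -- From the identity `∫ (1 - e^{-ux})² dμ = (1 - φ(u))² + φ(u)² (e^{2ψ(u) - ψ(2u)} - 1)`, divided
  -- by `u²`.
  have hI2 : Tendsto (fun n => ∫ x, expApprox (u n) x ^ 2 ∂μ) atTop
      (𝓝 ((∫ x, x ∂Λ) ^ 2 + ∫ x, x ^ 2 ∂Λ)) := by
    have e := (hφ1.pow 2).mul (tendsto_exp_sub_one_div hδ0 hδ)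
    rw [one_pow, one_mul] at e
    refine ((hI1.pow 2).add e).congr fun n => ?_
    have ie := integrable_exp_neg_mul h.nonneg (hu n).le
    have ie2 := integrable_exp_neg_mul h.nonneg (u := 2 * u n) (by linarith [hu n])
    have e1 : ∫ x, expApprox (u n) x ∂μ = (1 - φ (u n)) / u n := by
      simp only [expApprox, integral_div]
      rw [integral_sub (integrable_const _) ie]
      simp [hφ]
    have e2 : ∫ x, expApprox (u n) x ^ 2 ∂μ = (1 - 2 * φ (u n) + φ (2 * u n)) / u n ^ 2 := by
      simp only [expApprox, div_pow, integral_div]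
      congr 1
      have : ∀ x : ℝ, (1 - Real.exp (-u n * x)) ^ 2 =
          1 - 2 * Real.exp (-u n * x) + Real.exp (-(2 * u n) * x) := by
        intro x
        rw [show -(2 * u n) * x = (-u n * x) + (-u n * x) by ring, Real.exp_add]
        ring
      simp_rw [this]
      rw [integral_add (f := fun x => 1 - 2 * Real.exp (-u n * x))
        ((integrable_const _).sub (ie.const_mul 2)) ie2,
        integral_sub (integrable_const _) (ie.const_mul 2), integral_const_mul]
      simp [hφ]
    have e3 : φ (u n) ^ 2 * (Real.exp (2 * ψ (u n) - ψ (2 * u n)) - 1) =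
        φ (2 * u n) - φ (u n) ^ 2 := by
      rw [hφψ (hu n).le, hφψ (v := 2 * u n) (by linarith [hu n]), mul_sub, mul_one,
        ← Real.exp_nat_mul, ← Real.exp_add]
      congr 2
      push_cast
      ring
    rw [e1, e2, ← mul_div_assoc, e3, div_pow, ← add_div]
    congr 1
    ring
  -- Fatou's lemma, since the truncated second moments converge to a finite limit.
  have hintg : Integrable (fun x : ℝ => x ^ 2) μ := by
    refine ⟨by fun_prop, (hasFiniteIntegral_iff_ofReal (ae_of_all _ fun x => sq_nonneg x)).2 ?_⟩
    have hb (n : ℕ) : Integrable (fun x => expApprox (u n) x ^ 2) μ := by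
      refine Integrable.of_bound
        ((measurable_expApprox _).pow_const 2).aestronglyMeasurable ((1 / u n) ^ 2) ?_
      filter_upwards [h.nonneg] with x hx
      rw [Real.norm_of_nonneg (sq_nonneg _)]
      refine pow_le_pow_left₀ (expApprox_nonneg (hu n) hx) ?_ 2
      exact div_le_div_of_nonneg_right (by linarith [Real.exp_pos (-u n * x)]) (hu n).le
    calc ∫⁻ x, ENNReal.ofReal (x ^ 2) ∂μ
        = ∫⁻ x, liminf (fun n => ENNReal.ofReal (expApprox (u n) x ^ 2)) atTop ∂μ := by
          refine lintegral_congr fun x => (Tendsto.liminf_eq ?_).symm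
          exact ENNReal.tendsto_ofReal ((tendsto_expApprox hu hu0 x).pow 2)
      _ ≤ liminf (fun n => ∫⁻ x, ENNReal.ofReal (expApprox (u n) x ^ 2) ∂μ) atTop :=
          lintegral_liminf_le fun n => ((measurable_expApprox _).pow_const 2).ennreal_ofReal
      _ = ENNReal.ofReal ((∫ x, x ∂Λ) ^ 2 + ∫ x, x ^ 2 ∂Λ) := by
          refine Tendsto.liminf_eq ((ENNReal.tendsto_ofReal hI2).congr fun n => ?_)
          exact ofReal_integral_eq_lintegral_ofReal (hb n) (ae_of_all _ fun x => sq_nonneg _)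
      _ < ∞ := ENNReal.ofReal_lt_top
  have hmem : MemLp id 2 μ := (memLp_two_iff_integrable_sq aestronglyMeasurable_id).2 hintg
  refine ⟨hmem, ?_, tendsto_nhds_unique (tendsto_integral_expApprox h.nonneg hu hu0 2 hintg) hI2⟩
  have := tendsto_integral_expApprox h.nonneg hu hu0 1
    (by simpa only [pow_one] using! hmem.integrable one_le_two)
  simp only [pow_one] at this
  exact tendsto_nhds_unique this hI1

end Moments

/-! ### Second-order expansion of the characteristic exponent. -/

section NormalLimit

/-- The exponential series bound covers `|y| ≤ 1`. For `|y| ≥ 1` the triangle inequality gives `2 +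
|y| + y²/2 ≤ (7/2) |y|³`. -/
lemma norm_cexp_I_sub_taylor_le (y : ℝ) :
    ‖Complex.exp (y * Complex.I) - 1 - y * Complex.I + (y : ℂ) ^ 2 / 2‖ ≤ 4 * |y| ^ 3 := by
  have hn : ‖(y : ℂ) * Complex.I‖ = |y| := by simp
  rcases le_total |y| 1 with h | h
  · have := Complex.exp_bound (x := y * Complex.I) (by rwa [hn]) (n := 3) (by norm_num)
    rw [hn] at this
    have e : Complex.exp (y * Complex.I) -
        ∑ m ∈ Finset.range 3, ((y : ℂ) * Complex.I) ^ m / (m.factorial : ℂ) =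
        Complex.exp (y * Complex.I) - 1 - y * Complex.I + (y : ℂ) ^ 2 / 2 := by
      simp only [Finset.sum_range_succ, Finset.sum_range_zero, mul_pow, Complex.I_sq]
      norm_num [Nat.factorial]
      ring
    rw [e] at this
    refine this.trans ?_
    rw [mul_comm]
    refine mul_le_mul_of_nonneg_right ?_ (by positivity)
    norm_num [Nat.factorial]
  · have h1 : ‖Complex.exp (y * Complex.I)‖ = 1 := Complex.norm_exp_ofReal_mul_I y
    have h2 : ‖(y : ℂ) ^ 2 / 2‖ = |y| ^ 2 / 2 := by simp
    calc _ ≤ 1 + 1 + |y| + |y| ^ 2 / 2 := by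
          refine (norm_add_le _ _).trans (add_le_add ((norm_sub_le _ _).trans
            (add_le_add ((norm_sub_le _ _).trans (add_le_add h1.le (by simp))) hn.le)) h2.le)
      _ ≤ _ := by
          have h3 : |y| ^ 2 ≤ |y| ^ 3 := pow_le_pow_right₀ h (by norm_num)
          have h4 : |y| ≤ |y| ^ 3 := by simpa using pow_le_pow_right₀ h (show 1 ≤ 3 by norm_num)
          have h5 : 1 ≤ |y| ^ 3 := one_le_pow₀ h
          linarith

variable {μ Λ : Measure ℝ}

/-- Centering leaves the exponent `∫ (e^{ivx} - 1 - ivx) dΛ` with `v = s/σ`. Its quadratic part is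
Gaussian, and the Taylor remainder `r` is controlled by the third moment of `Λ`. -/
lemma HasLevyMeasure.exists_charFun_eq (h : HasLevyMeasure μ Λ) (h0 : ∀ᵐ x ∂Λ, 0 ≤ x)
    (hi1 : Integrable (fun x => x) Λ) (hi2 : Integrable (fun x => x ^ 2) Λ)
    (hi3 : Integrable (fun x => x ^ 3) Λ) (σ s : ℝ) :
    ∃ r : ℂ, ‖r‖ ≤ 4 * |s / σ| ^ 3 * ∫ x, x ^ 3 ∂Λ ∧
      charFun (μ.map fun x => (x - ∫ y, y ∂Λ) / σ) s =
        Complex.exp (((-((s / σ) ^ 2 / 2 * ∫ x, x ^ 2 ∂Λ) : ℝ) : ℂ) + r) := by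
  have := h.prob
  set v := s / σ with hv
  set m := ∫ y, y ∂Λ with hm
  set z : ℂ := v * Complex.I with hz
  have hzre : z.re ≤ 0 := by simp [hz]
  have hfin : ∫⁻ x, ENNReal.ofReal (1 - Real.exp (-x)) ∂Λ < ∞ := by
    have := (integrable_one_sub_exp_mul h0 hi1 zero_le_one)
    simp only [neg_mul, one_mul] at this
    refine (hasFiniteIntegral_iff_ofReal ?_).1 this.2
    filter_upwards [h0] with x hx using one_sub_exp_neg_nonneg hx
  have hc1 : Integrable (fun x : ℝ => z * x) Λ := (hi1.ofReal (𝕜 := ℂ)).const_mul z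
  have hc2 : Integrable (fun x : ℝ => ((v * x : ℝ) : ℂ) ^ 2 / 2) Λ := by
    refine ((hi2.ofReal (𝕜 := ℂ)).const_mul ((v : ℂ) ^ 2 / 2)).congr (ae_of_all _ fun x => ?_)
    change (v : ℂ) ^ 2 / 2 * ((x ^ 2 : ℝ) : ℂ) = ((v * x : ℝ) : ℂ) ^ 2 / 2
    push_cast
    ring
  have hce := integrable_cexp_sub_one h0 hfin hzre
  refine ⟨∫ x : ℝ, (Complex.exp ((v * x : ℝ) * Complex.I) - 1 - (v * x : ℝ) * Complex.I +
    ((v * x : ℝ) : ℂ) ^ 2 / 2) ∂Λ, ?_, ?_⟩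
  · refine (norm_integral_le_of_norm_le (hi3.const_mul (4 * |v| ^ 3)) ?_).trans ?_
    · filter_upwards [h0] with x hx
      refine (norm_cexp_I_sub_taylor_le (v * x)).trans ?_
      rw [abs_mul, abs_of_nonneg hx, mul_pow, mul_assoc]
    · rw [integral_const_mul]
  · have e1 : charFun (μ.map fun x => (x - m) / σ) s =
        Complex.exp (-(z * m)) * ∫ x : ℝ, Complex.exp (z * x) ∂μ := by
      rw [charFun_apply_real, integral_map (by fun_prop) (by fun_prop), ← integral_const_mul]
      congr 1
      ext x
      rw [← Complex.exp_add, hz, hv]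
      congr 1
      push_cast
      ring
    rw [e1, h.transform z hzre, ← Complex.exp_add]
    congr 1
    have e2 : z * m = ∫ x : ℝ, z * x ∂Λ := by
      rw [integral_const_mul, hm, ← integral_complex_ofReal]
    have e3 : ((v ^ 2 / 2 * ∫ x, x ^ 2 ∂Λ : ℝ) : ℂ) = ∫ x : ℝ, ((v * x : ℝ) : ℂ) ^ 2 / 2 ∂Λ := by
      rw [← integral_const_mul, ← integral_complex_ofReal]
      congr 1
      ext x
      push_cast
      ring
    have e4 : ∫ x : ℝ, (Complex.exp ((v * x : ℝ) * Complex.I) - 1 - (v * x : ℝ) * Complex.I +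
        ((v * x : ℝ) : ℂ) ^ 2 / 2) ∂Λ =
        ∫ x : ℝ, ((Complex.exp (z * x) - 1) - z * x + ((v * x : ℝ) : ℂ) ^ 2 / 2) ∂Λ := by
      congr 1
      ext x
      have : ((v * x : ℝ) : ℂ) * Complex.I = z * x := by rw [hz]; push_cast; ring
      rw [this]
    rw [e4, integral_add (f := fun x : ℝ => Complex.exp (z * x) - 1 - z * x) (hce.sub hc1) hc2,
       integral_sub hce hc1, Complex.ofReal_neg, e3, e2]
    ring

end NormalLimit

/-! ### Splitting a variable on its own probability space. -/

section Coupling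

lemma continuous_cdf {ν : Measure ℝ} [IsProbabilityMeasure ν] (h : ∀ x, ν {x} = 0) :
    Continuous (cdf ν) := by
  rw [continuous_iff_continuousAt]
  intro x
  rw [(monotone_cdf ν).continuousAt_iff_leftLim_eq_rightLim, (cdf ν).rightLim_eq]
  have h1 := (cdf ν).measure_singleton x
  rw [measure_cdf, h x, eq_comm, ENNReal.ofReal_eq_zero] at h1
  exact le_antisymm ((monotone_cdf ν).leftLim_le le_rfl) (by linarith)

/-- The probability integral transform: the distribution function maps a diffuse law to the
uniform law. -/
lemma exists_map_eq_volume_unitInterval (ν : Measure ℝ) [IsProbabilityMeasure ν]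
    (h : ∀ x, ν {x} = 0) :
    ∃ g : ℝ → unitInterval, Measurable g ∧ ν.map g = volume := by
  have hc := continuous_cdf h
  set F := cdf ν with hF
  set g : ℝ → unitInterval := fun x => ⟨F x, cdf_nonneg ν x, cdf_le_one ν x⟩ with hg
  have hgm : Measurable g := (hc.subtype_mk _).measurable
  have : IsProbabilityMeasure (ν.map g) := Measure.isProbabilityMeasure_map hgm.aemeasurable
  have hivt {u : ℝ} (h0 : 0 < u) (h1 : u < 1) : ∃ x, F x = u := by
    refine mem_range_of_exists_le_of_exists_ge hc ?_ ?_
    · exact ((tendsto_cdf_atBot ν).eventually_le_const h0).exists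
    · exact ((tendsto_cdf_atTop ν).eventually_const_le h1).exists
  refine ⟨g, hgm, Measure.ext_of_Iic _ _ fun u => ?_⟩
  rw [Measure.map_apply hgm measurableSet_Iic, unitInterval.volume_Iic]
  have hset : g ⁻¹' Iic u = {x | F x ≤ u} := by
    ext x
    simp [hg, ← Subtype.coe_le_coe]
  rw [hset]
  rcases eq_or_lt_of_le u.2.2 with hu1 | hu1
  · have : {x | F x ≤ u} = univ := by
      ext x
      simpa [hu1] using cdf_le_one ν x
    rw [this, hu1]
    simp
  · refine le_antisymm ?_ ?_
    -- `F` may be constant on intervals, so `{F ≤ u}` is bounded from outside by `{y ≤ x}` with `F x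
    -- = v`, and then `v` decreases to `u`.
    · have hlim : Tendsto (fun v : ℝ => ENNReal.ofReal v) (𝓝[>] (u : ℝ))
          (𝓝 (ENNReal.ofReal u)) :=
        (ENNReal.continuous_ofReal.tendsto _).mono_left nhdsWithin_le_nhds
      refine ge_of_tendsto hlim ?_
      filter_upwards [Ioo_mem_nhdsGT hu1] with v hv
      obtain ⟨x, hx⟩ := hivt (u.2.1.trans_lt hv.1) hv.2
      rw [← hx, hF, ofReal_cdf]
      refine measure_mono fun y (hy : F y ≤ u) => ?_
      by_contra hxy
      have := monotone_cdf ν (le_of_lt (not_le.1 hxy))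
      rw [← hF, hx] at this
      linarith [hv.1]
    · rcases eq_or_lt_of_le u.2.1 with hu0 | hu0
      · simp [← hu0]
      · obtain ⟨x, hx⟩ := hivt hu0 hu1
        rw [← hx, hF, ofReal_cdf]
        exact measure_mono fun y hy => monotone_cdf ν hy

/-- If `X` has law `μ₁ ∗ μ₂` and there is a diffuse variable independent of `X`, then `X` splits as
a sum of independent variables with laws `μ₁` and `μ₂` on the same probability space. -/
lemma exists_splitting {Ω : Type*} [MeasurableSpace Ω] {P : Measure Ω} [IsProbabilityMeasure P]
    {X W : Ω → ℝ} (hX : Measurable X) (hW : Measurable W) (hind : IndepFun X W P)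
    (hatom : ∀ c, P.map W {c} = 0) {μ₁ μ₂ : Measure ℝ} [IsProbabilityMeasure μ₁]
    [IsProbabilityMeasure μ₂] (hlaw : P.map X = μ₁ ∗ μ₂) :
    ∃ A : Ω → ℝ, Measurable A ∧ P.map (fun ω => (A ω, X ω - A ω)) = μ₁.prod μ₂ := by
  have : IsProbabilityMeasure (P.map W) := Measure.isProbabilityMeasure_map hW.aemeasurable
  obtain ⟨g, hgm, hg⟩ := exists_map_eq_volume_unitInterval (P.map W) hatom
  have hsum : Measurable fun p : ℝ × ℝ => p.1 + p.2 := by fun_prop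
  -- `κ` is the conditional law of the first summand given the sum; `f` samples it from a uniform
  -- variable, here obtained from `W`.
  set κ := condDistrib (fun p : ℝ × ℝ => p.1) (fun p => p.1 + p.2) (μ₁.prod μ₂) with hκ
  obtain ⟨f, hfm, hf⟩ := κ.exists_measurable_map_eq_unitInterval
  have hA : Measurable fun ω => f (X ω) (g (W ω)) := hfm.comp (hX.prodMk (hgm.comp hW))
  have hXV : P.map (fun ω => (X ω, g (W ω))) = (P.map X).prod volume := by
    have h1 : IndepFun X (g ∘ W) P := hind.comp measurable_id hgm
    rw [← hg, Measure.map_map hgm hW]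
    exact (indepFun_iff_map_prod_eq_prod_map_map hX.aemeasurable
      (hgm.comp hW).aemeasurable).1 h1
  have hXA : P.map (fun ω => (X ω, f (X ω) (g (W ω)))) = (P.map X) ⊗ₘ κ := by
    have hq : Measurable fun q : ℝ × unitInterval => (q.1, f q.1 q.2) :=
      measurable_fst.prodMk hfm
    have hXW : Measurable fun ω => (X ω, g (W ω)) := hX.prodMk (hgm.comp hW)
    have e : P.map (fun ω => (X ω, f (X ω) (g (W ω)))) =
        ((P.map X).prod volume).map fun q : ℝ × unitInterval => (q.1, f q.1 q.2) := by
      rw [← hXV, Measure.map_map hq hXW]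
      rfl
    have : IsProbabilityMeasure (P.map X) := Measure.isProbabilityMeasure_map hX.aemeasurable
    rw [e]
    ext s hs
    rw [Measure.map_apply hq hs, Measure.prod_apply (hq hs), Measure.compProd_apply hs]
    refine lintegral_congr fun x => ?_
    have hfx : Measurable (f x) := hfm.comp (measurable_const.prodMk measurable_id)
    rw [← hf x, Measure.map_apply hfx (measurable_prodMk_left hs)]
    rfl
  refine ⟨_, hA, ?_⟩
  have hr : Measurable fun q : ℝ × ℝ => (q.2, q.1 - q.2) := by fun_prop
  have e : P.map (fun ω => (f (X ω) (g (W ω)), X ω - f (X ω) (g (W ω)))) =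
      (P.map (fun ω => (X ω, f (X ω) (g (W ω))))).map fun q => (q.2, q.1 - q.2) := by
    rw [Measure.map_map hr (hX.prodMk hA)]
    rfl
  rw [e, hXA, hlaw, Measure.conv, hκ, compProd_map_condDistrib measurable_fst.aemeasurable,
    Measure.map_map hr (hsum.prodMk measurable_fst)]
  have : (fun q : ℝ × ℝ => (q.2, q.1 - q.2)) ∘ (fun a : ℝ × ℝ => (a.1 + a.2, a.1)) = id := by
    ext p <;> simp
  rw [this, Measure.map_id]

end Coupling

/-! ### The central limit theorem. -/

section NormalLimit

/-- A Lyapunov-type central limit theorem for infinitely divisible laws on `[0, ∞)`. -/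
lemma tendstoInDistribution_gaussian_of_hasLevyMeasure {Ω : Type*} [MeasurableSpace Ω]
    {P : Measure Ω} [IsProbabilityMeasure P] {ε : ℝ → Ω → ℝ} {Λ : ℝ → Measure ℝ}
    (hε : ∀ L, Measurable (ε L)) (h : ∀ L, 0 < L → HasLevyMeasure (P.map (ε L)) (Λ L))
    (h0 : ∀ L, 0 < L → ∀ᵐ x ∂Λ L, 0 ≤ x)
    (hi1 : ∀ L, 0 < L → Integrable (fun x => x) (Λ L))
    (hi2 : ∀ L, 0 < L → Integrable (fun x => x ^ 2) (Λ L))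
    (hi3 : ∀ L, 0 < L → Integrable (fun x => x ^ 3) (Λ L))
    (hpos : ∀ᶠ L in atTop, 0 < ∫ x, x ^ 2 ∂Λ L)
    (hlim : Tendsto (fun L => (∫ x, x ^ 3 ∂Λ L) / Real.sqrt (∫ x, x ^ 2 ∂Λ L) ^ 3) atTop (𝓝 0)) :
    TendstoInDistribution
      (fun (L : ℝ) ω => (ε L ω - ∫ ω', ε L ω' ∂P) / Real.sqrt (variance (ε L) P))
      atTop (id : ℝ → ℝ) (fun _ => P) (gaussianReal 0 1) := by
  have hm (L : ℝ) : AEMeasurable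
      (fun ω => (ε L ω - ∫ ω', ε L ω' ∂P) / Real.sqrt (variance (ε L) P)) P :=
    (((hε L).sub_const _).div_const _).aemeasurable
  refine ⟨hm, aemeasurable_id, ?_⟩
  refine tendsto_of_seq_tendsto fun L hL => ?_
  refine ProbabilityMeasure.tendsto_iff_tendsto_charFun.2 fun s => ?_
  -- The mean and variance of `ε l` are the first two moments of `Λ l`, so standardizing makes the
  -- quadratic part exactly `-s²/2` and bounds the error by the Lyapunov ratio.
  have key : ∀ᶠ l in atTop, ∃ r : ℂ, ‖r‖ ≤ 4 * |s| ^ 3 *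
      ((∫ x, x ^ 3 ∂Λ l) / Real.sqrt (∫ x, x ^ 2 ∂Λ l) ^ 3) ∧
      charFun (P.map fun ω => (ε l ω - ∫ ω', ε l ω' ∂P) / Real.sqrt (variance (ε l) P)) s =
        Complex.exp (((-(s ^ 2 / 2) : ℝ) : ℂ) + r) := by
    filter_upwards [hpos, eventually_gt_atTop 0] with l hl2 hl
    obtain ⟨hmem, hE, hE2⟩ := (h l hl).moments (h0 l hl) (hi1 l hl) (hi2 l hl)
    rw [integral_map (hε l).aemeasurable (by fun_prop)] at hE hE2
    have hmem' : MemLp (ε l) 2 P := by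
      have := (memLp_map_measure_iff aestronglyMeasurable_id (hε l).aemeasurable).1 hmem
      simpa using! this
    have hvar : variance (ε l) P = ∫ x, x ^ 2 ∂Λ l := by
      rw [variance_eq_sub hmem', hE]
      simp only [Pi.pow_apply]
      rw [hE2]
      ring
    obtain ⟨r, hr, hch⟩ := (h l hl).exists_charFun_eq (h0 l hl) (hi1 l hl) (hi2 l hl)
      (hi3 l hl) (Real.sqrt (variance (ε l) P)) s
    refine ⟨r, hr.trans_eq ?_, ?_⟩
    · rw [hvar, abs_div, abs_of_pos (Real.sqrt_pos.2 hl2)]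
      ring
    · rw [Measure.map_map (by fun_prop) (hε l)] at hch
      rw [hE]
      refine Eq.trans hch ?_
      congr 4
      rw [hvar, div_pow, Real.sq_sqrt hl2.le]
      field_simp
  have hcf : charFun ((gaussianReal 0 1).map id) s =
      Complex.exp (((-(s ^ 2 / 2) : ℝ) : ℂ) + 0) := by
    rw [Measure.map_id, charFun_gaussianReal]
    congr 1
    push_cast
    simp
  change Tendsto (fun n => charFun (P.map fun ω => (ε (L n) ω - ∫ ω', ε (L n) ω' ∂P) /
    Real.sqrt (variance (ε (L n)) P)) s) atTop (𝓝 (charFun ((gaussianReal 0 1).map id) s))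
  rw [hcf]
  refine Tendsto.comp (y := atTop) (g := fun l => charFun (P.map fun ω =>
    (ε l ω - ∫ ω', ε l ω' ∂P) / Real.sqrt (variance (ε l) P)) s) ?_ hL
  obtain ⟨r, hr⟩ := key.choice
  have hr0 : Tendsto r atTop (𝓝 0) := by
    have hb := hlim.const_mul (4 * |s| ^ 3)
    rw [mul_zero] at hb
    refine squeeze_zero_norm' ?_ hb
    filter_upwards [hr] with l hl using hl.1
  have := (Complex.continuous_exp.tendsto _).comp
    (hr0.const_add (((-(s ^ 2 / 2) : ℝ) : ℂ)))
  refine this.congr' ?_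
  filter_upwards [hr] with l hl using hl.2.symm

end NormalLimit

/-! ### From Thorin measures to Lévy measures. -/

section Thorin

/-- The Lévy measure `x⁻¹ (∫ e^{-xa} U(da)) dx` of the generalized gamma convolution with Thorin
measure `U`. -/
def thorinLevy (U : Measure ℝ) : Measure ℝ :=
  (volume.restrict (Ioi 0)).withDensity fun x =>
    ∫⁻ a, ENNReal.ofReal (x⁻¹ * Real.exp (-(a * x))) ∂U

instance sFinite_thorinLevy (U : Measure ℝ) : SFinite (thorinLevy U) := by
  unfold thorinLevy; infer_instance

lemma thorinLevy_absolutelyContinuous (U : Measure ℝ) : thorinLevy U ≪ volume.restrict (Ioi 0) :=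
  withDensity_absolutelyContinuous _ _

lemma ae_pos_thorinLevy (U : Measure ℝ) : ∀ᵐ x ∂thorinLevy U, 0 < x :=
  (thorinLevy_absolutelyContinuous U).ae_le (ae_restrict_mem measurableSet_Ioi)

lemma ae_nonneg_thorinLevy (U : Measure ℝ) : ∀ᵐ x ∂thorinLevy U, 0 ≤ x :=
  (ae_pos_thorinLevy U).mono fun _ hx => hx.le

lemma thorinLevy_singleton (U : Measure ℝ) (c : ℝ) : thorinLevy U {c} = 0 :=
  thorinLevy_absolutelyContinuous U
    (le_antisymm ((Measure.restrict_apply_le _ _).trans (by simp)) zero_le)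

variable {U : Measure ℝ} [SFinite U]

lemma measurable_thorinDensity :
    Measurable fun x => ∫⁻ a, ENNReal.ofReal (x⁻¹ * Real.exp (-(a * x))) ∂U :=
  Measurable.lintegral_prod_right' (f := fun p : ℝ × ℝ =>
    ENNReal.ofReal (p.1⁻¹ * Real.exp (-(p.2 * p.1)))) (by fun_prop)

lemma thorinLevy_add (U₁ U₂ : Measure ℝ) [SFinite U₁] [SFinite U₂] :
    thorinLevy (U₁ + U₂) = thorinLevy U₁ + thorinLevy U₂ := by
  unfold thorinLevy
  rw [← withDensity_add_left measurable_thorinDensity]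
  congr 1
  ext x
  rw [lintegral_add_measure, Pi.add_apply]

lemma lintegral_thorinLevy {f : ℝ → ℝ≥0∞} (hf : Measurable f) :
    ∫⁻ x, f x ∂thorinLevy U =
      ∫⁻ a, (∫⁻ x in Ioi 0, ENNReal.ofReal (x⁻¹ * Real.exp (-(a * x))) * f x) ∂U := by
  rw [thorinLevy, lintegral_withDensity_eq_lintegral_mul _ measurable_thorinDensity hf,
    lintegral_lintegral_swap (f := fun a x => ENNReal.ofReal (x⁻¹ * Real.exp (-(a * x))) * f x)
      (by fun_prop)]
  refine lintegral_congr fun x => ?_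
  rw [Pi.mul_apply, lintegral_mul_const _ (by fun_prop)]

/-- Frullani's integral for `e^{-x}` between the scales `a` and `a + u`, with integrability from the
bound `u e^{-ax}`. The extended nonnegative form lets Tonelli be used before any finiteness is
known. -/
lemma lintegral_frullani {a u : ℝ} (ha : 0 < a) (hu : 0 ≤ u) :
    ∫⁻ x in Ioi 0, ENNReal.ofReal (x⁻¹ * Real.exp (-(a * x))) *
      ENNReal.ofReal (1 - Real.exp (-u * x)) = ENNReal.ofReal (Real.log (1 + u / a)) := by
  have hb : 0 < a + u := by linarith
  have hid (x : ℝ) : x⁻¹ • (Real.exp (-(a * x)) - Real.exp (-((a + u) * x))) =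
      x⁻¹ * Real.exp (-(a * x)) * (1 - Real.exp (-u * x)) := by
    rw [smul_eq_mul, show -((a + u) * x) = -(a * x) + -u * x by ring, Real.exp_add]
    ring
  have hpos : ∀ x ∈ Ioi (0 : ℝ), 0 ≤ x⁻¹ * Real.exp (-(a * x)) * (1 - Real.exp (-u * x)) := by
    intro x hx
    have hx' : 0 < x := hx
    have := one_sub_exp_neg_nonneg (x := u * x) (by positivity)
    rw [neg_mul]
    positivity
  have hintg : IntegrableOn
      (fun x => x⁻¹ • (Real.exp (-(a * x)) - Real.exp (-((a + u) * x)))) (Ioi 0) := by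
    have hexp : IntegrableOn (fun x => u * Real.exp (-a * x)) (Ioi 0) :=
      (integrableOn_exp_mul_Ioi (by linarith) 0).const_mul u
    refine hexp.mono' (by fun_prop) ?_
    filter_upwards [ae_restrict_mem measurableSet_Ioi] with x hx
    rw [hid, Real.norm_of_nonneg (hpos x hx)]
    have hx' : 0 < x := hx
    have h1 : 1 - Real.exp (-u * x) ≤ u * x := by linarith [Real.add_one_le_exp (-u * x)]
    calc x⁻¹ * Real.exp (-(a * x)) * (1 - Real.exp (-u * x))
        ≤ x⁻¹ * Real.exp (-(a * x)) * (u * x) := by gcongr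
      _ = u * Real.exp (-a * x) := by
          rw [neg_mul]
          field_simp
  have hfr := Frullani.integral_Ioi_eq (f := fun x : ℝ => Real.exp (-x)) (L := (1 : ℝ)) (R := 0)
    (a := a) (b := a + u)
    ((by fun_prop : Continuous fun x : ℝ => Real.exp (-x)).locallyIntegrable.locallyIntegrableOn _)
    ha hb ?_ Real.tendsto_exp_neg_atTop_nhds_zero hintg
  · rw [show 1 + u / a = (a + u) / a by field_simp]
    rw [sub_zero, smul_eq_mul, mul_one] at hfr
    rw [← hfr, ofReal_integral_eq_lintegral_ofReal hintg]
    · refine setLIntegral_congr_fun measurableSet_Ioi fun x hx => ?_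
      have hx' : 0 < x := hx
      change _ = ENNReal.ofReal _
      rw [hid, ← ENNReal.ofReal_mul (by positivity)]
    · filter_upwards [ae_restrict_mem measurableSet_Ioi] with x hx
      rw [hid]
      exact hpos x hx
  · have : Tendsto (fun x : ℝ => Real.exp (-x)) (𝓝 0) (𝓝 1) := by
      have h : Continuous fun x : ℝ => Real.exp (-x) := by fun_prop
      simpa using h.tendsto 0
    exact this.mono_left nhdsWithin_le_nhds

lemma lintegral_gammaMoment {a : ℝ} (ha : 0 < a) (k : ℕ) :
    ∫⁻ x in Ioi 0, ENNReal.ofReal (x⁻¹ * Real.exp (-(a * x))) * ENNReal.ofReal (x ^ (k + 1)) =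
      ENNReal.ofReal (k.factorial / a ^ (k + 1)) := by
  have h := Real.integral_rpow_mul_exp_neg_mul_Ioi (a := k + 1) (r := a) (by positivity) ha
  have hval : (1 / a) ^ ((k : ℝ) + 1) * Real.Gamma (k + 1) = k.factorial / a ^ (k + 1) := by
    rw [Real.Gamma_nat_eq_factorial, show ((k : ℝ) + 1) = ((k + 1 : ℕ) : ℝ) by push_cast; ring,
      Real.rpow_natCast, one_div, inv_pow]
    ring
  rw [hval] at h
  rw [← h, ofReal_integral_eq_lintegral_ofReal]
  · refine setLIntegral_congr_fun measurableSet_Ioi fun x hx => ?_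
    have hx' : 0 < x := hx
    rw [← ENNReal.ofReal_mul (by positivity), add_sub_cancel_right, Real.rpow_natCast]
    congr 1
    field_simp
    ring
  · refine Integrable.of_integral_ne_zero ?_
    rw [h]
    positivity
  · filter_upwards [ae_restrict_mem measurableSet_Ioi] with x hx
    have hx' : 0 < x := hx
    positivity

lemma lintegral_one_sub_exp_thorinLevy (h0 : ∀ᵐ a ∂U, 0 < a) {u : ℝ} (hu : 0 ≤ u) :
    ∫⁻ x, ENNReal.ofReal (1 - Real.exp (-u * x)) ∂thorinLevy U =
      ∫⁻ a, ENNReal.ofReal (Real.log (1 + u / a)) ∂U := by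
  rw [lintegral_thorinLevy (by fun_prop)]
  refine lintegral_congr_ae ?_
  filter_upwards [h0] with a ha using lintegral_frullani ha hu

lemma log_one_add_div_nonneg {u a : ℝ} (hu : 0 ≤ u) (ha : 0 < a) :
    0 ≤ Real.log (1 + u / a) :=
  Real.log_nonneg (by have := div_nonneg hu ha.le; linarith)

lemma measurable_log_one_add_div (u : ℝ) : Measurable fun a : ℝ => Real.log (1 + u / a) := by
  fun_prop

lemma integral_one_sub_exp_thorinLevy (h0 : ∀ᵐ a ∂U, 0 < a) {u : ℝ} (hu : 0 ≤ u) :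
    ∫ x, (1 - Real.exp (-u * x)) ∂thorinLevy U = ∫ a, Real.log (1 + u / a) ∂U := by
  rw [integral_eq_lintegral_of_nonneg_ae _ (by fun_prop),
    integral_eq_lintegral_of_nonneg_ae _ (measurable_log_one_add_div u).aestronglyMeasurable,
    lintegral_one_sub_exp_thorinLevy h0 hu]
  · filter_upwards [h0] with a ha using log_one_add_div_nonneg hu ha
  · filter_upwards [ae_nonneg_thorinLevy U] with x hx
    rw [neg_mul]
    exact one_sub_exp_neg_nonneg (by positivity)

lemma lintegral_pow_thorinLevy (h0 : ∀ᵐ a ∂U, 0 < a) (k : ℕ) :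
    ∫⁻ x, ENNReal.ofReal (x ^ (k + 1)) ∂thorinLevy U =
      ∫⁻ a, ENNReal.ofReal (k.factorial / a ^ (k + 1)) ∂U := by
  rw [lintegral_thorinLevy (by fun_prop)]
  refine lintegral_congr_ae ?_
  filter_upwards [h0] with a ha using lintegral_gammaMoment ha k

/-- For each `a > 0` the mass of `x⁻¹ e^{-ax} dx` dominates every Frullani integral `log (1 + u/a)`,
which is unbounded in `u`. -/
lemma thorinLevy_univ (h0 : ∀ᵐ a ∂U, 0 < a) (hU : U ≠ 0) : thorinLevy U univ = ∞ := by
  have h := lintegral_thorinLevy (U := U) (f := fun _ => 1) measurable_const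
  rw [lintegral_one] at h
  rw [h]
  have hinner : ∀ᵐ a ∂U,
      ∫⁻ x in Ioi 0, ENNReal.ofReal (x⁻¹ * Real.exp (-(a * x))) * 1 = ∞ := by
    filter_upwards [h0] with a ha
    have hlim : Tendsto (fun u : ℝ => ENNReal.ofReal (Real.log (1 + u / a))) atTop (𝓝 ∞) := by
      refine ENNReal.tendsto_ofReal_atTop.comp (Real.tendsto_log_atTop.comp ?_)
      exact tendsto_atTop_add_const_left _ _ (tendsto_id.atTop_div_const ha)
    refine top_unique (le_of_tendsto hlim ?_)
    filter_upwards [eventually_ge_atTop 0] with u hu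
    rw [← lintegral_frullani ha hu]
    refine lintegral_mono fun x => mul_le_mul_right ?_ _
    rw [← ENNReal.ofReal_one]
    exact ENNReal.ofReal_le_ofReal (by linarith [Real.exp_pos (-u * x)])
  rw [lintegral_congr_ae hinner, lintegral_const, ENNReal.top_mul]
  simpa using hU

end Thorin

/-! ### Integrability conditions on Thorin measures. -/

section ThorinMeasure

variable {U : Measure ℝ}

/-- The single function `log (1 + 1/a)` controls all three conditions: it is bounded below on
compact sets, at least `|log a|` on `(0, 1]`, and at least `1/(2a)` beyond `1`. -/
lemma isThorinMeasure_of_lintegral (h0 : ∀ᵐ a ∂U, 0 < a)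
    (hfin : ∫⁻ a, ENNReal.ofReal (Real.log (1 + 1 / a)) ∂U < ∞) : IsThorinMeasure U where
  support := by
    rw [ae_iff] at h0
    convert h0 using 2
    ext x
    simp
  radon K hK hK0 := by
    rcases K.eq_empty_or_nonempty with rfl | hne
    · simp
    obtain ⟨b, hbK, hb⟩ := hK.exists_isGreatest hne
    have hb0 : 0 < b := hK0 hbK
    have hc : 0 < Real.log (1 + 1 / b) := Real.log_pos (by have := one_div_pos.2 hb0; linarith)
    have hle : ENNReal.ofReal (Real.log (1 + 1 / b)) * U K ≤
        ∫⁻ a, ENNReal.ofReal (Real.log (1 + 1 / a)) ∂U := by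
      rw [← setLIntegral_const]
      refine (setLIntegral_mono (by fun_prop) fun a ha => ?_).trans
        (setLIntegral_le_lintegral K _)
      have ha0 : 0 < a := hK0 ha
      refine ENNReal.ofReal_le_ofReal (Real.log_le_log (by positivity) ?_)
      have := one_div_le_one_div_of_le ha0 (hb ha)
      linarith
    exact ENNReal.lt_top_of_mul_ne_top_right (hle.trans_lt hfin).ne (by simpa using hc)
  near_zero := by
    refine lt_of_le_of_lt ?_ hfin
    refine (setLIntegral_mono (by fun_prop) fun a ha => ?_).trans (setLIntegral_le_lintegral _ _)
    refine ENNReal.ofReal_le_ofReal ?_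
    rw [abs_of_nonpos (Real.log_nonpos ha.1.le ha.2), ← Real.log_inv]
    refine Real.log_le_log (inv_pos.2 ha.1) ?_
    rw [one_div]
    linarith
  at_top := by
    have h2 : ∫⁻ a, ENNReal.ofReal 2 * ENNReal.ofReal (Real.log (1 + 1 / a)) ∂U < ∞ := by
      rw [lintegral_const_mul _ (by fun_prop)]
      exact ENNReal.mul_lt_top ENNReal.ofReal_lt_top hfin
    refine lt_of_le_of_lt ?_ h2
    refine (setLIntegral_mono (by fun_prop) fun a ha => ?_).trans (setLIntegral_le_lintegral _ _)
    have ha1 : 1 < a := ha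
    rw [← ENNReal.ofReal_mul (by norm_num)]
    refine ENNReal.ofReal_le_ofReal ?_
    have h1 := Real.one_sub_inv_le_log_of_pos (x := 1 + 1 / a) (by positivity)
    have h3 : 1 - (1 + 1 / a)⁻¹ = 1 / (a + 1) := by
      field_simp
      ring
    have h4 : a⁻¹ ≤ 2 * (1 / (a + 1)) := by
      rw [← one_div, mul_one_div, div_le_div_iff₀ (by linarith) (by linarith)]
      linarith
    linarith

/-- Bernoulli's inequality for `(1 + y)^(1+u)`. It carries integrability from `u = 1` to every `u ≥
0`. -/
lemma log_one_add_mul_le {u y : ℝ} (hu : 0 ≤ u) (hy : 0 ≤ y) :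
    Real.log (1 + u * y) ≤ (1 + u) * Real.log (1 + y) := by
  have h1 := one_add_mul_self_le_rpow_one_add (s := y) (p := 1 + u) (by linarith) (by linarith)
  rw [← Real.log_rpow (by linarith)]
  refine Real.log_le_log (by positivity) (le_trans ?_ h1)
  nlinarith

lemma integrable_log_one_add_div (h0 : ∀ᵐ a ∂U, 0 < a)
    (hfin : ∫⁻ a, ENNReal.ofReal (Real.log (1 + 1 / a)) ∂U < ∞) {u : ℝ} (hu : 0 ≤ u) :
    Integrable (fun a => Real.log (1 + u / a)) U := by
  have h1 : Integrable (fun a => Real.log (1 + 1 / a)) U := by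
    refine ⟨(measurable_log_one_add_div 1).aestronglyMeasurable,
      (hasFiniteIntegral_iff_ofReal ?_).2 hfin⟩
    filter_upwards [h0] with a ha using log_one_add_div_nonneg zero_le_one ha
  refine (h1.const_mul (1 + u)).mono' (measurable_log_one_add_div u).aestronglyMeasurable ?_
  filter_upwards [h0] with a ha
  rw [Real.norm_of_nonneg (log_one_add_div_nonneg hu ha), div_eq_mul_one_div u a]
  exact log_one_add_mul_le hu (by positivity)

end ThorinMeasure

/-! ### The Thorin measure of the time change. -/

section TimeChange

lemma isProbabilityMeasure_ratioLaw {Y : ℝ} (hY : 0 < Y) : IsProbabilityMeasure (ratioLaw Y) := by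
  have := isProbabilityMeasure_gammaMeasure (a := Y / 2) (r := 1) (by positivity) one_pos
  have := isProbabilityMeasure_gammaMeasure (a := 1 / 2) (r := 1) (by norm_num) one_pos
  exact Measure.isProbabilityMeasure_map (by fun_prop)

instance sFinite_ratioLaw (Y : ℝ) : SFinite (ratioLaw Y) := by
  unfold ratioLaw gammaMeasure; infer_instance

lemma ae_nonneg_gammaMeasure (a r : ℝ) : ∀ᵐ x ∂gammaMeasure a r, 0 ≤ x := by
  rw [gammaMeasure, ae_withDensity_iff (by unfold gammaPDF; fun_prop)]
  refine ae_of_all _ fun x hx => ?_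
  by_contra h
  exact hx (gammaPDF_of_neg (not_le.1 h))

lemma ae_nonneg_ratioLaw {Y : ℝ} (hY : 0 < Y) : ∀ᵐ r ∂ratioLaw Y, 0 ≤ r := by
  have := isProbabilityMeasure_gammaMeasure (a := Y / 2) (r := 1) (by positivity) one_pos
  have := isProbabilityMeasure_gammaMeasure (a := 1 / 2) (r := 1) (by norm_num) one_pos
  rw [ratioLaw, ae_map_iff (by fun_prop) measurableSet_Ici]
  have h1 : ∀ᵐ p ∂((gammaMeasure (Y / 2) 1).prod (gammaMeasure (1 / 2) 1)), 0 ≤ p.1 :=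
    Measure.quasiMeasurePreserving_fst.ae (ae_nonneg_gammaMeasure _ _)
  have h2 : ∀ᵐ p ∂((gammaMeasure (Y / 2) 1).prod (gammaMeasure (1 / 2) 1)), 0 ≤ p.2 :=
    Measure.quasiMeasurePreserving_snd.ae (ae_nonneg_gammaMeasure _ _)
  filter_upwards [h1, h2] with p hp hq using div_nonneg hp hq

/-- The random rate `(G M + θ̃² r) / 2`. -/
def rate (G M r : ℝ) : ℝ := (G * M + (thetaTilde G M) ^ 2 * r) / 2

@[fun_prop]
lemma measurable_rate (G M : ℝ) : Measurable (rate G M) := by unfold rate; fun_prop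

lemma rate_nonneg {G M r : ℝ} (hG : 0 ≤ G) (hM : 0 ≤ M) (hr : 0 ≤ r) : 0 ≤ rate G M r := by
  unfold rate; positivity

/-- The measure `c z^{Y/2 - 1} dz` on `S`. -/
def powerMeasure (c Y : ℝ) (S : Set ℝ) : Measure ℝ :=
  (volume.restrict S).withDensity fun z => ENNReal.ofReal (c * z ^ (Y / 2 - 1))

instance sFinite_powerMeasure (c Y : ℝ) (S : Set ℝ) :
    SFinite (powerMeasure c Y S) := by
  unfold powerMeasure; infer_instance

/-- The part of the Thorin measure of the time change that comes from `z ∈ S`. -/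
def thorinPart (c G M Y : ℝ) (S : Set ℝ) : Measure ℝ :=
  ((ratioLaw Y).prod (powerMeasure c Y S)).map fun p => rate G M p.1 + p.2

instance sFinite_thorinPart (c G M Y : ℝ) (S : Set ℝ) : SFinite (thorinPart c G M Y S) := by
  unfold thorinPart; infer_instance

variable {c G M Y : ℝ}

lemma measurable_rate_add (G M : ℝ) : Measurable fun p : ℝ × ℝ => rate G M p.1 + p.2 := by
  fun_prop

lemma lintegral_thorinPart {S : Set ℝ} {f : ℝ → ℝ≥0∞} (hf : Measurable f) :
    ∫⁻ a, f a ∂thorinPart c G M Y S =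
      ∫⁻ r, (∫⁻ z in S, ENNReal.ofReal (c * z ^ (Y / 2 - 1)) * f (rate G M r + z)) ∂ratioLaw Y := by
  rw [thorinPart, lintegral_map hf (measurable_rate_add G M), lintegral_prod _ (by fun_prop)]
  refine lintegral_congr fun r => ?_
  rw [powerMeasure, lintegral_withDensity_eq_lintegral_mul _ (by fun_prop) (by fun_prop)]
  rfl

lemma ae_lt_thorinPart (hY : 0 < Y) (hG : 0 ≤ G) (hM : 0 ≤ M) {S : Set ℝ} (hS : MeasurableSet S)
    {b : ℝ} (hb : ∀ z ∈ S, b < z) : ∀ᵐ a ∂thorinPart c G M Y S, b < a := by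
  rw [thorinPart, ae_map_iff (measurable_rate_add G M).aemeasurable measurableSet_Ioi]
  have h1 : ∀ᵐ p ∂((ratioLaw Y).prod (powerMeasure c Y S)), 0 ≤ p.1 :=
    Measure.quasiMeasurePreserving_fst.ae (ae_nonneg_ratioLaw hY)
  have h2 : ∀ᵐ p ∂((ratioLaw Y).prod (powerMeasure c Y S)), b < p.2 := by
    refine Measure.quasiMeasurePreserving_snd.ae (p := fun z => b < z) ?_
    refine (withDensity_absolutelyContinuous _ _).ae_le ?_
    filter_upwards [ae_restrict_mem hS] with z hz using hb z hz
  filter_upwards [h1, h2] with p hp hq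
  have := rate_nonneg hG hM hp
  linarith

lemma thorinPart_union {S S' : Set ℝ} (hd : Disjoint S S') (hS' : MeasurableSet S') :
    thorinPart c G M Y (S ∪ S') = thorinPart c G M Y S + thorinPart c G M Y S' := by
  have h : powerMeasure c Y (S ∪ S') = powerMeasure c Y S + powerMeasure c Y S' := by
    unfold powerMeasure
    rw [Measure.restrict_union hd hS', withDensity_add_measure]
  unfold thorinPart
  rw [h, Measure.prod_add, Measure.map_add _ _ (measurable_rate_add G M)]

/-- The Lévy density of the time change at time `t` is that of a generalized gamma convolution. -/
lemma ofReal_timeChangeLevyDensity {C t : ℝ} (hC : 0 < C) (ht : 0 < t)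
    (hY : 0 < Y) {x : ℝ} (hx : 0 < x) :
    ENNReal.ofReal (t * timeChangeLevyDensity C G M Y x) =
      ∫⁻ a, ENNReal.ofReal (x⁻¹ * Real.exp (-(a * x)))
        ∂thorinPart (cTilde C Y t) G M Y (Ioi 0) := by
  have := isProbabilityMeasure_ratioLaw hY
  have hΓ := Real.Gamma_pos_of_pos hY
  have hΓ2 := Real.Gamma_pos_of_pos (show 0 < Y / 2 by positivity)
  have hc : 0 < cTilde C Y t := by unfold cTilde; positivity
  have hgam := Real.integral_rpow_mul_exp_neg_mul_Ioi (a := Y / 2) (r := x) (by positivity) hx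
  -- Integrating `z` out yields the gamma factor `x^(-Y/2) Γ(Y/2)`, and `rate` contributes the two
  -- exponentials of the Lévy density.
  have hinner (r : ℝ) : ∫⁻ z in Ioi 0, ENNReal.ofReal (cTilde C Y t * z ^ (Y / 2 - 1)) *
      ENNReal.ofReal (x⁻¹ * Real.exp (-((rate G M r + z) * x))) =
      ENNReal.ofReal (cTilde C Y t * x⁻¹ * ((1 / x) ^ (Y / 2) * Real.Gamma (Y / 2)) *
        Real.exp (-(G * M * x / 2))) *
      ENNReal.ofReal (Real.exp (-((thetaTilde G M) ^ 2 * x / 2) * r)) := by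
    rw [← ENNReal.ofReal_mul (by positivity), ← hgam]
    have e : cTilde C Y t * x⁻¹ * (∫ z in Ioi 0, z ^ (Y / 2 - 1) * Real.exp (-(x * z))) *
        Real.exp (-(G * M * x / 2)) * Real.exp (-((thetaTilde G M) ^ 2 * x / 2) * r) =
        ∫ z in Ioi 0, cTilde C Y t * x⁻¹ * Real.exp (-(G * M * x / 2)) *
          Real.exp (-((thetaTilde G M) ^ 2 * x / 2) * r) *
          (z ^ (Y / 2 - 1) * Real.exp (-(x * z))) := by
      rw [integral_const_mul]
      ring
    rw [e, ofReal_integral_eq_lintegral_ofReal]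
    · refine setLIntegral_congr_fun measurableSet_Ioi fun z hz => ?_
      have hz' : 0 < z := hz
      rw [← ENNReal.ofReal_mul (by positivity)]
      congr 1
      have : -((rate G M r + z) * x) =
          -(G * M * x / 2) + -((thetaTilde G M) ^ 2 * x / 2) * r + -(x * z) := by
        unfold rate; ring
      rw [this, Real.exp_add, Real.exp_add]
      ring
    · refine Integrable.const_mul (Integrable.of_integral_ne_zero ?_) _
      rw [hgam]
      positivity
    · filter_upwards [ae_restrict_mem measurableSet_Ioi] with z hz
      have hz' : 0 < z := hz
      positivity
  rw [lintegral_thorinPart (by fun_prop)]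
  simp_rw [hinner]
  rw [lintegral_const_mul _ (by fun_prop), ← ofReal_integral_eq_lintegral_ofReal _
    (ae_of_all _ fun r => (Real.exp_pos _).le), ← ENNReal.ofReal_mul (by positivity)]
  · congr 1
    unfold timeChangeLevyDensity cTilde
    have e1 : (thetaTilde G M) ^ 2 - (theta G M) ^ 2 = G * M := by
      unfold thetaTilde theta; ring
    have e2 : -(G * M) * x / 2 = -(G * M * x / 2) := by ring
    have e3 : (1 / x) ^ (Y / 2) = (x ^ (Y / 2))⁻¹ := by
      rw [one_div, Real.inv_rpow hx.le]
    rw [e1, e2, e3, Real.rpow_add hx, Real.rpow_one]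
    field_simp
  · have hb : ∀ᵐ r ∂ratioLaw Y,
        ‖Real.exp (-((thetaTilde G M) ^ 2 * x / 2) * r)‖ ≤ 1 := by
      filter_upwards [ae_nonneg_ratioLaw hY] with r hr
      rw [Real.norm_of_nonneg (Real.exp_pos _).le, Real.exp_le_one_iff, neg_mul, neg_nonpos]
      positivity
    exact Integrable.of_bound (by fun_prop) 1 hb

lemma lintegral_thorinLevy_thorinPart {C t : ℝ} (hC : 0 < C) (ht : 0 < t) (hY : 0 < Y)
    {f : ℝ → ℝ≥0∞} (hf : Measurable f) :
    ∫⁻ x, f x ∂thorinLevy (thorinPart (cTilde C Y t) G M Y (Ioi 0)) =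
      ∫⁻ x in Ioi 0, ENNReal.ofReal (t * timeChangeLevyDensity C G M Y x) * f x := by
  rw [thorinLevy, lintegral_withDensity_eq_lintegral_mul _ measurable_thorinDensity hf]
  refine setLIntegral_congr_fun measurableSet_Ioi fun x hx => ?_
  rw [Pi.mul_apply, ofReal_timeChangeLevyDensity hC ht hY hx]

end TimeChange

/-! ### The truncated Thorin measure and the law of `R`. -/

section Ratio

variable {C G M Y t L : ℝ}

/-- The scalar is the total mass `∫₀ᴸ c z^(Y/2-1) dz`; the endpoint `0` is negligible. -/
lemma powerMeasure_Ioc_eq_smul_zLaw {c : ℝ} (hc : 0 < c) (hY : 0 < Y) (hL : 0 < L) :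
    powerMeasure c Y (Ioc 0 L) = ENNReal.ofReal (2 * c * L ^ (Y / 2) / Y) • zLaw Y L := by
  unfold powerMeasure zLaw
  rw [← withDensity_smul _ (by fun_prop), ← Measure.restrict_congr_set Ioc_ae_eq_Icc]
  refine withDensity_congr_ae ?_
  filter_upwards [ae_restrict_mem measurableSet_Ioc] with z hz
  have hz0 : 0 < z := hz.1
  rw [Pi.smul_apply, smul_eq_mul, ← ENNReal.ofReal_mul (by positivity)]
  congr 1
  rw [Real.rpow_neg hL.le]
  have := (Real.rpow_pos_of_pos hL (Y / 2)).ne'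
  field_simp

/-- The law of `1 / R`. -/
def invRLaw (G M Y L : ℝ) : Measure ℝ :=
  ((ratioLaw Y).prod (zLaw Y L)).map fun p => rate G M p.1 + p.2

lemma rLaw_eq_map : rLaw G M Y L = (invRLaw G M Y L).map fun a => 1 / a := by
  unfold rLaw invRLaw
  rw [Measure.map_map (by fun_prop) (measurable_rate_add G M)]
  rfl

lemma thorinPart_Ioc_eq_smul_invRLaw {c : ℝ} (hc : 0 < c) (hY : 0 < Y) (hL : 0 < L) :
    thorinPart c G M Y (Ioc 0 L) =
      ENNReal.ofReal (2 * c * L ^ (Y / 2) / Y) • invRLaw G M Y L := by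
  have : SFinite (zLaw Y L) := by unfold zLaw; infer_instance
  unfold thorinPart invRLaw
  rw [powerMeasure_Ioc_eq_smul_zLaw hc hY hL, Measure.prod_smul_right, Measure.map_smul]

lemma integrable_log_rLaw {c : ℝ} (hc : 0 < c) (hY : 0 < Y) (hL : 0 < L) {u : ℝ}
    (h : Integrable (fun a => Real.log (1 + u / a)) (thorinPart c G M Y (Ioc 0 L))) :
    Integrable (fun r => Real.log (1 + u * r)) (rLaw G M Y L) := by
  rw [thorinPart_Ioc_eq_smul_invRLaw hc hY hL, integrable_smul_measure
    (by rw [← pos_iff_ne_zero, ENNReal.ofReal_pos]; positivity) ENNReal.ofReal_ne_top] at h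
  have hm : Measurable fun r : ℝ => Real.log (1 + u * r) := by fun_prop
  rw [rLaw_eq_map, integrable_map_measure hm.aestronglyMeasurable (by fun_prop)]
  simpa [Function.comp_def, div_eq_mul_inv] using h

lemma integral_log_thorinPart_Ioc {c : ℝ} (hc : 0 < c) (hY : 0 < Y) (hL : 0 < L) (u : ℝ) :
    ∫ a, Real.log (1 + u / a) ∂thorinPart c G M Y (Ioc 0 L) =
      2 * c * L ^ (Y / 2) / Y * ∫ r, Real.log (1 + u * r) ∂rLaw G M Y L := by
  have hm : Measurable fun r : ℝ => Real.log (1 + u * r) := by fun_prop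
  rw [thorinPart_Ioc_eq_smul_invRLaw hc hY hL, integral_smul_measure,
    ENNReal.toReal_ofReal (by positivity), rLaw_eq_map,
    integral_map (by fun_prop) hm.aestronglyMeasurable, smul_eq_mul]
  simp [div_eq_mul_inv]

end Ratio

/-! ### Moment estimates for the remainder. -/

section Remainder

variable {c G M Y L : ℝ}

lemma lintegral_Ioi_rpow (hc : 0 ≤ c) (hL : 0 < L) {q : ℝ} (hq : 0 < q) :
    ∫⁻ z in Ioi L, ENNReal.ofReal (c * z ^ (-q - 1)) = ENNReal.ofReal (c * L ^ (-q) / q) := by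
  have hi := integrableOn_Ioi_rpow_of_lt (a := -q - 1) (c := L) (by linarith) hL
  rw [← ofReal_integral_eq_lintegral_ofReal (hi.const_mul c), integral_const_mul,
    integral_Ioi_rpow_of_lt (by linarith) hL]
  · congr 1
    rw [sub_add_cancel, neg_div_neg_eq, mul_div_assoc]
  · filter_upwards [ae_restrict_mem measurableSet_Ioi] with z hz
    have : 0 < z := hL.trans hz
    positivity

/-- Since `rate ≥ 0`, replacing `rate + z` by `z` only increases the integrand and leaves a power
integral. -/
lemma lintegral_inv_pow_thorinPart_le (hc : 0 < c) (hG : 0 ≤ G) (hM : 0 ≤ M) (hY : 0 < Y)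
    (hY2 : Y < 2) (hL : 0 < L) (k : ℕ) :
    ∫⁻ a, ENNReal.ofReal (1 / a ^ (k + 1)) ∂thorinPart c G M Y (Ioi L) ≤
      ENNReal.ofReal (c * L ^ (-((k + 1 : ℝ) - Y / 2)) / ((k + 1 : ℝ) - Y / 2)) := by
  have := isProbabilityMeasure_ratioLaw hY
  have hk : (0 : ℝ) ≤ k := Nat.cast_nonneg k
  rw [lintegral_thorinPart (by fun_prop), ← lintegral_Ioi_rpow hc.le hL (by linarith)]
  calc _ ≤ ∫⁻ _, (∫⁻ z in Ioi L,
        ENNReal.ofReal (c * z ^ (-((k + 1 : ℝ) - Y / 2) - 1))) ∂ratioLaw Y := by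
        refine lintegral_mono_ae ?_
        filter_upwards [ae_nonneg_ratioLaw hY] with r hr
        refine setLIntegral_mono (by fun_prop) fun z hz => ?_
        have hz0 : 0 < z := hL.trans hz
        have hr0 := rate_nonneg hG hM hr
        rw [← ENNReal.ofReal_mul (by positivity)]
        refine ENNReal.ofReal_le_ofReal ?_
        have e : z ^ (-((k + 1 : ℝ) - Y / 2) - 1) = z ^ (Y / 2 - 1) * (1 / z ^ (k + 1)) := by
          rw [show -((k + 1 : ℝ) - Y / 2) - 1 = (Y / 2 - 1) - ((k + 1 : ℕ) : ℝ) by push_cast; ring,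
            Real.rpow_sub hz0, Real.rpow_natCast, mul_one_div]
        rw [e, mul_assoc]
        gcongr
        linarith
    _ = _ := by simp

/-- On an event `rate ≤ n` of positive probability, `rate + z ≤ 2z` as soon as `z > L ≥ n + 1`. This
costs the factor `1/4`, and `b` retains the probability of the event. -/
lemma exists_le_lintegral_inv_sq_thorinPart (hc : 0 < c) (hG : 0 ≤ G) (hM : 0 ≤ M) (hY : 0 < Y)
    (hY2 : Y < 2) : ∃ b K : ℝ, 0 < b ∧ 0 < K ∧ ∀ L, K ≤ L →
      ENNReal.ofReal (b * L ^ (-(2 - Y / 2))) ≤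
        ∫⁻ a, ENNReal.ofReal (1 / a ^ 2) ∂thorinPart c G M Y (Ioi L) := by
  have := isProbabilityMeasure_ratioLaw hY
  obtain ⟨n, hn⟩ : ∃ n : ℕ, 0 < ratioLaw Y {r | rate G M r ≤ n} := by
    refine exists_measure_pos_of_not_measure_iUnion_null ?_
    have : ⋃ n : ℕ, {r | rate G M r ≤ n} = univ :=
      eq_univ_of_forall fun r => mem_iUnion.2 (exists_nat_ge (rate G M r))
    rw [this, measure_univ]
    exact one_ne_zero
  have hp : 0 < (ratioLaw Y).real {r | rate G M r ≤ n} :=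
    ENNReal.toReal_pos hn.ne' (measure_ne_top _ _)
  have hS : MeasurableSet {r | rate G M r ≤ n} := measurableSet_le (by fun_prop) measurable_const
  have hY' : 0 < 2 - Y / 2 := by linarith
  refine ⟨c / 4 / (2 - Y / 2) * (ratioLaw Y).real {r | rate G M r ≤ n}, n + 1, by positivity,
    by positivity, fun L hL => ?_⟩
  have hn0 : (0 : ℝ) ≤ n := Nat.cast_nonneg n
  have hL0 : 0 < L := by linarith
  rw [lintegral_thorinPart (by fun_prop)]
  calc _ = ∫⁻ _ in {r | rate G M r ≤ n}, (∫⁻ z in Ioi L,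
        ENNReal.ofReal (c / 4 * z ^ (-(2 - Y / 2) - 1))) ∂ratioLaw Y := by
        rw [lintegral_Ioi_rpow (by positivity) hL0 hY', setLIntegral_const, ← ofReal_measureReal,
          ← ENNReal.ofReal_mul (by positivity)]
        congr 1
        ring
    _ ≤ ∫⁻ r in {r | rate G M r ≤ n}, (∫⁻ z in Ioi L, ENNReal.ofReal (c * z ^ (Y / 2 - 1)) *
        ENNReal.ofReal (1 / (rate G M r + z) ^ 2)) ∂ratioLaw Y := by
        refine lintegral_mono_ae ?_
        filter_upwards [ae_restrict_of_ae (ae_nonneg_ratioLaw hY), ae_restrict_mem hS]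
          with r hr hrn
        refine setLIntegral_mono (by fun_prop) fun z hz => ?_
        have hzL : L < z := hz
        have hz0 : 0 < z := hL0.trans hz
        have hr0 := rate_nonneg hG hM hr
        have hrn' : rate G M r ≤ n := hrn
        rw [← ENNReal.ofReal_mul (by positivity)]
        refine ENNReal.ofReal_le_ofReal ?_
        have e : c / 4 * z ^ (-(2 - Y / 2) - 1) = c * z ^ (Y / 2 - 1) * (1 / (2 * z) ^ 2) := by
          rw [show -(2 - Y / 2) - 1 = (Y / 2 - 1) - ((2 : ℕ) : ℝ) by push_cast; ring,
            Real.rpow_sub hz0, Real.rpow_natCast]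
          field_simp
          norm_num
        rw [e]
        gcongr
        linarith
    _ ≤ _ := setLIntegral_le_lintegral _ _

lemma moment_thorinLevy_Ioi (hc : 0 < c) (hG : 0 ≤ G) (hM : 0 ≤ M) (hY : 0 < Y)
    (hY2 : Y < 2) (hL : 0 < L) (k : ℕ) :
    Integrable (fun x => x ^ (k + 1)) (thorinLevy (thorinPart c G M Y (Ioi L))) ∧
      ∫ x, x ^ (k + 1) ∂thorinLevy (thorinPart c G M Y (Ioi L)) ≤
        k.factorial * (c * L ^ (-((k + 1 : ℝ) - Y / 2)) / ((k + 1 : ℝ) - Y / 2)) := by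
  set U := thorinPart c G M Y (Ioi L) with hU
  have hk : (0 : ℝ) ≤ k := Nat.cast_nonneg k
  have hq : 0 < (k + 1 : ℝ) - Y / 2 := by linarith
  have h0 : ∀ᵐ a ∂U, 0 < a :=
    ae_lt_thorinPart hY hG hM measurableSet_Ioi fun z (hz : L < z) => hL.trans hz
  have hle : ∫⁻ x, ENNReal.ofReal (x ^ (k + 1)) ∂thorinLevy U ≤ ENNReal.ofReal
      (k.factorial * (c * L ^ (-((k + 1 : ℝ) - Y / 2)) / ((k + 1 : ℝ) - Y / 2))) := by
    rw [lintegral_pow_thorinLevy h0, ENNReal.ofReal_mul (by positivity)]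
    have e (a : ℝ) : ENNReal.ofReal (k.factorial / a ^ (k + 1)) =
        ENNReal.ofReal k.factorial * ENNReal.ofReal (1 / a ^ (k + 1)) := by
      rw [← ENNReal.ofReal_mul (by positivity), mul_one_div]
    simp_rw [e]
    rw [lintegral_const_mul _ (by fun_prop)]
    gcongr
    exact lintegral_inv_pow_thorinPart_le hc hG hM hY hY2 hL k
  have hnn : 0 ≤ᵐ[thorinLevy U] fun x => x ^ (k + 1) := by
    filter_upwards [ae_nonneg_thorinLevy U] with x hx using pow_nonneg hx _
  have hi : Integrable (fun x => x ^ (k + 1)) (thorinLevy U) :=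
    ⟨by fun_prop, (hasFiniteIntegral_iff_ofReal hnn).2 (hle.trans_lt ENNReal.ofReal_lt_top)⟩
  refine ⟨hi, ?_⟩
  rw [← ofReal_integral_eq_lintegral_ofReal hi hnn] at hle
  exact (ENNReal.ofReal_le_ofReal_iff (by positivity)).1 hle

lemma exists_le_second_moment_thorinLevy_Ioi (hc : 0 < c) (hG : 0 ≤ G) (hM : 0 ≤ M) (hY : 0 < Y)
    (hY2 : Y < 2) : ∃ b K : ℝ, 0 < b ∧ 0 < K ∧ ∀ L, K ≤ L →
      b * L ^ (-(2 - Y / 2)) ≤ ∫ x, x ^ 2 ∂thorinLevy (thorinPart c G M Y (Ioi L)) := by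
  obtain ⟨b, K, hb, hK, h⟩ := exists_le_lintegral_inv_sq_thorinPart hc hG hM hY hY2
  refine ⟨b, K, hb, hK, fun L hL => ?_⟩
  have hL0 : 0 < L := hK.trans_le hL
  have h0 : ∀ᵐ a ∂thorinPart c G M Y (Ioi L), 0 < a :=
    ae_lt_thorinPart hY hG hM measurableSet_Ioi fun z (hz : L < z) => hL0.trans hz
  have hi := (moment_thorinLevy_Ioi hc hG hM hY hY2 hL0 1).1
  have hm := lintegral_pow_thorinLevy h0 1
  norm_num at hm hi
  have h' := h L hL
  simp only [one_div] at h'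
  rw [← hm, ← ofReal_integral_eq_lintegral_ofReal hi (ae_of_all _ fun x => sq_nonneg x)] at h'
  exact (ENNReal.ofReal_le_ofReal_iff (integral_nonneg fun x => sq_nonneg x)).1 h'

/-- The third moment is at most of order `L^{-(3-Y/2)}`, while the variance to the power `3/2` is at
least of order `L^{-(3-3Y/4)}`; the quotient leaves `L^{-Y/4}`. -/
lemma tendsto_lyapunov_ratio (hc : 0 < c) (hG : 0 ≤ G) (hM : 0 ≤ M) (hY : 0 < Y) (hY2 : Y < 2) :
    (∀ᶠ L in atTop, 0 < ∫ x, x ^ 2 ∂thorinLevy (thorinPart c G M Y (Ioi L))) ∧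
    Tendsto (fun L => (∫ x, x ^ 3 ∂thorinLevy (thorinPart c G M Y (Ioi L))) /
      Real.sqrt (∫ x, x ^ 2 ∂thorinLevy (thorinPart c G M Y (Ioi L))) ^ 3) atTop (𝓝 0) := by
  obtain ⟨b, K, hb, hK, h⟩ := exists_le_second_moment_thorinLevy_Ioi hc hG hM hY hY2
  constructor
  · filter_upwards [eventually_ge_atTop K] with L hL
    have hL0 : 0 < L := hK.trans_le hL
    exact lt_of_lt_of_le (by positivity) (h L hL)
  · have hlim := (tendsto_rpow_neg_atTop (show 0 < Y / 4 by positivity)).const_mul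
      (2 * (c / (3 - Y / 2)) / Real.sqrt b ^ 3)
    rw [mul_zero] at hlim
    refine squeeze_zero' ?_ ?_ hlim
    · filter_upwards with L
      refine div_nonneg (integral_nonneg_of_ae ?_) (by positivity)
      filter_upwards [ae_nonneg_thorinLevy _] with x hx using pow_nonneg hx _
    · filter_upwards [eventually_ge_atTop K] with L hL
      have hL0 : 0 < L := hK.trans_le hL
      have h3 := (moment_thorinLevy_Ioi hc hG hM hY hY2 hL0 2).2
      norm_num at h3
      have hs : Real.sqrt b * L ^ (-(1 - Y / 4)) ≤
          Real.sqrt (∫ x, x ^ 2 ∂thorinLevy (thorinPart c G M Y (Ioi L))) := by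
        refine Real.le_sqrt_of_sq_le (le_trans (le_of_eq ?_) (h L hL))
        rw [mul_pow, Real.sq_sqrt hb.le, ← Real.rpow_natCast, ← Real.rpow_mul hL0.le]
        congr 2
        push_cast
        ring
      have hY3 : 0 < 3 - Y / 2 := by linarith
      calc _ ≤ (2 * (c * L ^ (-(3 - Y / 2)) / (3 - Y / 2))) /
            (Real.sqrt b * L ^ (-(1 - Y / 4))) ^ 3 := by
            gcongr
            convert! h3 using 3
            norm_num
        _ = _ := by
            have e : L ^ (-(3 - Y / 2)) = L ^ (-(Y / 4)) * (L ^ (-(1 - Y / 4))) ^ 3 := by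
              rw [← Real.rpow_natCast, ← Real.rpow_mul hL0.le, ← Real.rpow_add hL0]
              congr 1
              push_cast
              ring
            rw [e]
            have := (Real.rpow_pos_of_pos hL0 (-(1 - Y / 4))).ne'
            have := (Real.sqrt_pos.2 hb).ne'
            field_simp

end Remainder

/-! ### Decomposing the subordinator at a fixed time. -/

section Decomposition

variable {Ω : Type*} [MeasurableSpace Ω] {P : Measure Ω} {T : ℝ≥0 → Ω → ℝ}

lemma IsSubordinator.ae_nonneg (hT : IsSubordinator T P) (s : ℝ≥0) :
    ∀ᵐ x ∂P.map (T s), 0 ≤ x := by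
  rw [ae_map_iff (hT.measurable s).aemeasurable measurableSet_Ici]
  filter_upwards [hT.zero, hT.paths] with ω h0 hp
  have : T 0 ω ≤ T s ω := hp.1 zero_le
  rwa [h0] at this

variable {C G M Y : ℝ} {t : ℝ≥0}

lemma cTilde_pos (hC : 0 < C) (hY : 0 < Y) (ht : 0 < t) : 0 < cTilde C Y t := by
  have := Real.Gamma_pos_of_pos hY
  have : (0 : ℝ) < t := ht
  unfold cTilde
  positivity

lemma lintegral_log_thorinPart_lt_top (hC : 0 < C) (hG : 0 ≤ G) (hM : 0 ≤ M) (hY : 0 < Y)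
    (hν : HasLevyDensity T P (timeChangeLevyDensity C G M Y)) (ht : 0 < t) :
    ∫⁻ a, ENNReal.ofReal (Real.log (1 + 1 / a)) ∂thorinPart (cTilde C Y t) G M Y (Ioi 0) < ∞ := by
  have ht' : (0 : ℝ) < t := ht
  have h0 : ∀ᵐ a ∂thorinPart (cTilde C Y t) G M Y (Ioi 0), 0 < a :=
    ae_lt_thorinPart hY hG hM measurableSet_Ioi fun z hz => hz
  rw [← lintegral_one_sub_exp_thorinLevy h0 zero_le_one,
    lintegral_thorinLevy_thorinPart hC ht' hY (by fun_prop)]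
  have hi := hν.integrable.const_mul (t : ℝ)
  refine lt_of_le_of_lt (setLIntegral_mono_ae' measurableSet_Ioi (ae_of_all _ fun x hx => ?_))
    ((hasFiniteIntegral_iff_ofReal ?_).1 hi.2)
  · have hx' : 0 < x := hx
    have hν0 := hν.nonneg x hx
    rw [← ENNReal.ofReal_mul (by positivity)]
    refine ENNReal.ofReal_le_ofReal ?_
    have : 1 - Real.exp (-1 * x) ≤ min 1 x := by
      refine le_min ?_ ?_
      · linarith [Real.exp_pos (-1 * x)]
      · linarith [Real.add_one_le_exp (-1 * x)]
    calc _ ≤ t * timeChangeLevyDensity C G M Y x * min 1 x := by gcongr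
      _ = _ := by ring
  · filter_upwards [ae_restrict_mem measurableSet_Ioi] with x hx
    have hx' : 0 < x := hx
    have hν0 := hν.nonneg x hx
    have : 0 ≤ min 1 x := le_min zero_le_one hx'.le
    positivity

lemma integral_one_sub_exp_mul_density (hC : 0 < C) (hY : 0 < Y)
    (hν : HasLevyDensity T P (timeChangeLevyDensity C G M Y)) (ht : 0 < t) {u : ℝ} (hu : 0 ≤ u) :
    ∫ x, (1 - Real.exp (-u * x)) ∂thorinLevy (thorinPart (cTilde C Y t) G M Y (Ioi 0)) =
      t * ∫ x in Ioi (0 : ℝ), (1 - Real.exp (-u * x)) * timeChangeLevyDensity C G M Y x := by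
  have ht' : (0 : ℝ) < t := ht
  -- Measurability of the density is read off from that of `min 1 x * ν x` by dividing by `min 1 x >
  -- 0`.
  have hm : AEStronglyMeasurable (timeChangeLevyDensity C G M Y) (volume.restrict (Ioi 0)) := by
    have hinv : Measurable fun x : ℝ => (min 1 x)⁻¹ := by fun_prop
    refine (hinv.aestronglyMeasurable.mul hν.integrable.1).congr ?_
    filter_upwards [ae_restrict_mem measurableSet_Ioi] with x hx
    have hx' : 0 < x := hx
    have : 0 < min 1 x := lt_min one_pos hx'
    simp only [Pi.mul_apply]
    field_simp
  have he {x : ℝ} (hx : 0 ≤ x) : 0 ≤ 1 - Real.exp (-u * x) := by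
    rw [neg_mul]
    exact one_sub_exp_neg_nonneg (by positivity)
  rw [← integral_const_mul, integral_eq_lintegral_of_nonneg_ae _ (by fun_prop),
    integral_eq_lintegral_of_nonneg_ae]
  · rw [lintegral_thorinLevy_thorinPart hC ht' hY (by fun_prop)]
    congr 1
    refine setLIntegral_congr_fun measurableSet_Ioi fun x hx => ?_
    have hν0 := hν.nonneg x hx
    rw [← ENNReal.ofReal_mul (by positivity)]
    congr 1
    ring
  · filter_upwards [ae_restrict_mem measurableSet_Ioi] with x hx
    exact mul_nonneg ht'.le (mul_nonneg (he (le_of_lt hx)) (hν.nonneg x hx))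
  · have hexp : AEStronglyMeasurable (fun x : ℝ => 1 - Real.exp (-u * x))
        (volume.restrict (Ioi 0)) := by fun_prop
    exact (hexp.mul hm).const_mul (t : ℝ)
  · filter_upwards [ae_nonneg_thorinLevy _] with x hx using he hx

/-- The hypothesis on `T` gives only the real Laplace transform. Matching it with a constructed law
also provides the complex transform. -/
lemma hasLevyMeasure_map_subordinator [IsProbabilityMeasure P]
    (hC : 0 < C) (hG : 0 ≤ G) (hM : 0 ≤ M) (hY : 0 < Y)
    (hT : IsSubordinator T P) (hν : HasLevyDensity T P (timeChangeLevyDensity C G M Y))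
    (ht : 0 < t) :
    HasLevyMeasure (P.map (T t)) (thorinLevy (thorinPart (cTilde C Y t) G M Y (Ioi 0))) := by
  have h0 : ∀ᵐ a ∂thorinPart (cTilde C Y t) G M Y (Ioi 0), 0 < a :=
    ae_lt_thorinPart hY hG hM measurableSet_Ioi fun z hz => hz
  have hfin := lintegral_log_thorinPart_lt_top hC hG hM hY hν ht
  rw [← lintegral_one_sub_exp_thorinLevy h0 zero_le_one] at hfin
  simp only [neg_mul, one_mul] at hfin
  obtain ⟨μ, hμ⟩ := exists_hasLevyMeasure _ (ae_nonneg_thorinLevy _) hfin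
  have := hμ.prob
  have := Measure.isProbabilityMeasure_map (μ := P) (hT.measurable t).aemeasurable
  have heq : P.map (T t) = μ := by
    refine ext_of_laplace (hT.ae_nonneg t) hμ.nonneg fun u hu => ?_
    rw [hμ.laplace hu, integral_map (hT.measurable t).aemeasurable (by fun_prop),
      hν.laplace t u hu, integral_one_sub_exp_mul_density hC hY hν ht hu, neg_mul]
  rwa [heq]

lemma exists_decomposition [IsProbabilityMeasure P]
    (hC : 0 < C) (hG : 0 ≤ G) (hM : 0 ≤ M) (hY : 0 < Y) (hY2 : Y < 2)
    (hT : IsSubordinator T P) (hν : HasLevyDensity T P (timeChangeLevyDensity C G M Y))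
    (ht : 0 < t) {L : ℝ} (hL : 0 < L) :
    ∃ A : Ω → ℝ, Measurable A ∧ IndepFun A (fun ω => T t ω - A ω) P ∧
      HasLevyMeasure (P.map A) (thorinLevy (thorinPart (cTilde C Y t) G M Y (Ioc 0 L))) ∧
      HasLevyMeasure (P.map fun ω => T t ω - A ω)
        (thorinLevy (thorinPart (cTilde C Y t) G M Y (Ioi L))) := by
  have hc := cTilde_pos (C := C) hC hY ht
  set U := thorinPart (cTilde C Y t) G M Y (Ioi 0) with hU
  set U₁ := thorinPart (cTilde C Y t) G M Y (Ioc 0 L) with hU₁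
  set U₂ := thorinPart (cTilde C Y t) G M Y (Ioi L) with hU₂
  have hUadd : U = U₁ + U₂ := by
    rw [hU, ← Ioc_union_Ioi_eq_Ioi hL.le]
    exact thorinPart_union (Ioc_disjoint_Ioi le_rfl) measurableSet_Ioi
  have h0 : ∀ᵐ a ∂U, 0 < a := ae_lt_thorinPart hY hG hM measurableSet_Ioi fun z hz => hz
  have hlaw := hasLevyMeasure_map_subordinator hC hG hM hY hT hν ht
  rw [← hU] at hlaw
  have hfin : ∫⁻ x, ENNReal.ofReal (1 - Real.exp (-x)) ∂thorinLevy U < ∞ := by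
    have := lintegral_log_thorinPart_lt_top hC hG hM hY hν ht
    rw [← lintegral_one_sub_exp_thorinLevy h0 zero_le_one] at this
    simpa only [neg_mul, one_mul] using this
  -- The lower bound on `∫ a⁻² dU` over the piece `z > K` excludes the zero measure.
  have hUne : U ≠ 0 := by
    intro h
    obtain ⟨b, K, hb, hK, hle⟩ := exists_le_lintegral_inv_sq_thorinPart hc hG hM hY hY2
    have hsub : U = thorinPart (cTilde C Y t) G M Y (Ioc 0 K) +
        thorinPart (cTilde C Y t) G M Y (Ioi K) := by
      rw [hU, ← Ioc_union_Ioi_eq_Ioi hK.le]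
      exact thorinPart_union (Ioc_disjoint_Ioi le_rfl) measurableSet_Ioi
    have hz : thorinPart (cTilde C Y t) G M Y (Ioi K) = 0 := by
      rw [← Measure.measure_univ_eq_zero]
      have := congrArg (fun ρ : Measure ℝ => ρ univ) (hsub.symm.trans h)
      simp only [Measure.add_apply, Measure.coe_zero, Pi.zero_apply, add_eq_zero] at this
      exact this.2
    have := hle K le_rfl
    rw [hz, lintegral_zero_measure, nonpos_iff_eq_zero, ENNReal.ofReal_eq_zero] at this
    have hpos : 0 < b * K ^ (-(2 - Y / 2)) := by positivity
    linarith
  have hfin₁₂ := hfin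
  rw [hUadd, thorinLevy_add, lintegral_add_measure, ENNReal.add_lt_top] at hfin₁₂
  obtain ⟨μ₁, hμ₁⟩ := exists_hasLevyMeasure _ (ae_nonneg_thorinLevy U₁) hfin₁₂.1
  obtain ⟨μ₂, hμ₂⟩ := exists_hasLevyMeasure _ (ae_nonneg_thorinLevy U₂) hfin₁₂.2
  have := hμ₁.prob
  have := hμ₂.prob
  have hconv : P.map (T t) = μ₁ ∗ μ₂ := by
    have h := hμ₁.conv hμ₂
      (fun z hz => integrable_cexp_sub_one (ae_nonneg_thorinLevy U₁) hfin₁₂.1 hz)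
      (fun z hz => integrable_cexp_sub_one (ae_nonneg_thorinLevy U₂) hfin₁₂.2 hz)
    rw [← thorinLevy_add, ← hUadd] at h
    exact hlaw.unique h
  -- The next increment supplies the independent randomness: by stationarity it has the diffuse law
  -- of `T t`.
  have hWm : Measurable (T (t + t) - T t) := (hT.measurable _).sub (hT.measurable _)
  have hWlaw : P.map (T (t + t) - T t) = P.map (T t) := (hT.stationary t t).map_eq
  obtain ⟨A, hA, hAlaw⟩ := exists_splitting (hT.measurable t) hWm
    (hT.indep.indepFun_eval_sub zero_le le_self_add hT.zero)
    (fun c => by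
      rw [hWlaw]
      exact hlaw.measure_singleton (ae_pos_thorinLevy U) hfin (thorinLevy_singleton U)
        (thorinLevy_univ h0 hUne) c) hconv
  have hB : Measurable fun ω => T t ω - A ω := (hT.measurable t).sub hA
  have h1 : P.map A = μ₁ := by
    have := congrArg Measure.fst hAlaw
    rwa [Measure.fst_map_prodMk hB, Measure.fst_prod] at this
  have h2 : P.map (fun ω => T t ω - A ω) = μ₂ := by
    have := congrArg Measure.snd hAlaw
    rwa [Measure.snd_map_prodMk hA, Measure.snd_prod] at this
  refine ⟨A, hA, ?_, h1 ▸ hμ₁, h2 ▸ hμ₂⟩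
  rw [indepFun_iff_map_prod_eq_prod_map_map hA.aemeasurable hB.aemeasurable, hAlaw, h1, h2]

end Decomposition

end CGMY

end

/-! ### Assembly of the main theorem. -/

theorem theorem1 {Ω : Type*} [MeasurableSpace Ω] (P : Measure Ω) [IsProbabilityMeasure P]
    (C G M Y : ℝ) (hC : 0 < C) (hG : 0 ≤ G) (hM : 0 ≤ M) (hY0 : 0 < Y) (hY2 : Y < 2)
    (T : ℝ≥0 → Ω → ℝ) (hT : CGMY.IsSubordinator T P)
    (hν : CGMY.HasLevyDensity T P (CGMY.timeChangeLevyDensity C G M Y))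
    (t : ℝ≥0) (ht : 0 < t) :
    ∃ TL ε : ℝ → Ω → ℝ,
      (∀ L : ℝ, 0 < L →
        Measurable (TL L) ∧ Measurable (ε L) ∧
        (∀ ω, T t ω = TL L ω + ε L ω) ∧
        IndepFun (TL L) (ε L) P ∧
        CGMY.IsGenGammaConvolution (P.map (TL L)) ∧
        (∀ u : ℝ, 0 < u →
          Integrable (fun r => Real.log (1 + u * r)) (CGMY.rLaw G M Y L) ∧
          -Real.log (∫ ω, Real.exp (-u * TL L ω) ∂P) =
            2 * CGMY.cTilde C Y t * L ^ (Y / 2) / Y *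
              ∫ r, Real.log (1 + u * r) ∂(CGMY.rLaw G M Y L)) ∧
        MemLp (ε L) 2 P ∧
        ∫ ω, (ε L ω) ^ 2 ∂P ≤
          (CGMY.cTilde C Y t) ^ 2 / ((1 - Y / 2) ^ 2 * L ^ (2 - Y)) +
            CGMY.cTilde C Y t / ((2 - Y / 2) * L ^ (2 - Y / 2))) ∧
      TendstoInDistribution
        (fun (L : ℝ) ω => (ε L ω - ∫ ω', ε L ω' ∂P) / Real.sqrt (variance (ε L) P))
        atTop (id : ℝ → ℝ) (fun _ => P) (gaussianReal 0 1) := by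
  open CGMY in
  have hc : 0 < cTilde C Y t := cTilde_pos hC hY0 ht
  have hex : ∀ L : ℝ, ∃ A : Ω → ℝ, Measurable A ∧ (0 < L →
      IndepFun A (fun ω => T t ω - A ω) P ∧
      HasLevyMeasure (P.map A) (thorinLevy (thorinPart (cTilde C Y t) G M Y (Ioc 0 L))) ∧
      HasLevyMeasure (P.map fun ω => T t ω - A ω)
        (thorinLevy (thorinPart (cTilde C Y t) G M Y (Ioi L)))) := by
    intro L
    by_cases hL : 0 < L
    · obtain ⟨A, hA, h⟩ := exists_decomposition hC hG hM hY0 hY2 hT hν ht hL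
      exact ⟨A, hA, fun _ => h⟩
    -- The value for `L ≤ 0` is arbitrary; measurability for every `L` is what the limit theorem
    -- requires.
    · exact ⟨fun _ => 0, measurable_const, fun h => absurd h hL⟩
  choose TL hTLm hTL using hex
  have hεm (L : ℝ) : Measurable fun ω => T t ω - TL L ω := (hT.measurable t).sub (hTLm L)
  have hmom {L : ℝ} (hL : 0 < L) (k : ℕ) := moment_thorinLevy_Ioi hc hG hM hY0 hY2 hL k
  have hi1 (L : ℝ) (hL : 0 < L) :
      Integrable (fun x => x) (thorinLevy (thorinPart (cTilde C Y t) G M Y (Ioi L))) := by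
    simpa using (hmom hL 0).1
  have hi2 (L : ℝ) (hL : 0 < L) := (hmom hL 1).1
  have hi3 (L : ℝ) (hL : 0 < L) := (hmom hL 2).1
  refine ⟨TL, fun L ω => T t ω - TL L ω, fun L hL => ?_, ?_⟩
  · obtain ⟨hind, hlaw₁, hlaw₂⟩ := hTL L hL
    have hpos : ∀ᵐ a ∂thorinPart (cTilde C Y t) G M Y (Ioc 0 L), 0 < a :=
      ae_lt_thorinPart hY0 hG hM measurableSet_Ioc fun z hz => hz.1
    have hfin : ∫⁻ a, ENNReal.ofReal (Real.log (1 + 1 / a))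
        ∂thorinPart (cTilde C Y t) G M Y (Ioc 0 L) < ∞ := by
      refine lt_of_le_of_lt (lintegral_mono' ?_ le_rfl)
        (lintegral_log_thorinPart_lt_top hC hG hM hY0 hν ht)
      rw [← Ioc_union_Ioi_eq_Ioi hL.le,
        thorinPart_union (Ioc_disjoint_Ioi le_rfl) measurableSet_Ioi]
      exact Measure.le_add_right le_rfl
    have hlap {u : ℝ} (hu : 0 ≤ u) : ∫ x, Real.exp (-u * x) ∂P.map (TL L) =
        Real.exp (-∫ a, Real.log (1 + u / a) ∂thorinPart (cTilde C Y t) G M Y (Ioc 0 L)) := by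
      rw [hlaw₁.laplace hu, integral_one_sub_exp_thorinLevy hpos hu]
    have hmoments := hlaw₂.moments (ae_nonneg_thorinLevy _) (hi1 L hL) (hi2 L hL)
    refine ⟨hTLm L, hεm L, fun ω => by ring, hind, ⟨hlaw₁.prob, ?_, _,
      isThorinMeasure_of_lintegral hpos hfin, fun u hu => hlap hu⟩, fun u hu => ⟨?_, ?_⟩, ?_, ?_⟩
    · have := hlaw₁.nonneg
      rw [ae_iff] at this
      convert this using 2
      ext x
      simp
    · exact integrable_log_rLaw hc hY0 hL (integrable_log_one_add_div hpos hfin hu.le)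
    · have h := hlap hu.le
      rw [integral_map (hTLm L).aemeasurable (by fun_prop)] at h
      rw [h, Real.log_exp, neg_neg, integral_log_thorinPart_Ioc hc hY0 hL]
    · have := (memLp_map_measure_iff aestronglyMeasurable_id (hεm L).aemeasurable).1 hmoments.1
      simpa using! this
    · have h2 := hmoments.2.2
      rw [integral_map (hεm L).aemeasurable (by fun_prop)] at h2
      rw [h2]
      have hb1 := (hmom hL 0).2
      have hb2 := (hmom hL 1).2
      norm_num at hb1 hb2
      have hm0 : 0 ≤ ∫ x, x ∂thorinLevy (thorinPart (cTilde C Y t) G M Y (Ioi L)) :=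
        integral_nonneg_of_ae (ae_nonneg_thorinLevy _)
      -- The second moment of `ε L` is the squared first moment plus the second moment of its Lévy
      -- measure, which match the two terms of the bound.
      refine add_le_add ((pow_le_pow_left₀ hm0 hb1 2).trans_eq ?_) (hb2.trans_eq ?_)
      · rw [show 2 - Y = (1 - Y / 2) * (2 : ℕ) by push_cast; ring, Real.rpow_mul hL.le,
          Real.rpow_natCast, show Y / 2 - 1 = -(1 - Y / 2) by ring, Real.rpow_neg hL.le]
        field_simp
      · rw [show Y / 2 - 2 = -(2 - Y / 2) by ring, Real.rpow_neg hL.le]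
        field_simp
  · obtain ⟨hpos, hlim⟩ := tendsto_lyapunov_ratio hc hG hM hY0 hY2
    exact tendstoInDistribution_gaussian_of_hasLevyMeasure hεm (fun L hL => (hTL L hL).2.2)
      (fun L _ => ae_nonneg_thorinLevy _) hi1 hi2 hi3 hpos hlim
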